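/- Let $(R,\mathfrak m)$ be a regular local ring containing a field, let $I$ be an ideal of $R$ containing an element $x\in\mathfrak m\setminus\mathfrak m^2$, and set $\overline R=R/(x)$ and $\overline I=I\overline R$. For an ideal $J$ of a regular local ring $S$, say that *the question holds for $J$* if the following implication is true: if $S/J$ is Cohen–Macaulay, $J$ is generically a complete intersection (that is, $J_{\mathfrak p}$ is generated by an $S_{\mathfrak p}$-regular sequence for every $\mathfrak p\in\operatorname{Ass}_S(S/J)$), and $J/J^2$ is a Cohen–Macaulay $S$-module, then $S/J$ is Gorenstein. Here the zero module is regarded as Cohen–Macaulay, while the zero ring is not regarded as a Cohen–Macaulay ring. Then: 1. the $R/I$-submodule of $I/I^2$ generated by the image of $x$ is isomorphic to $R/I$ and is a direct summand of $I/I^2$; 2. $\overline R$ is a regular local ring, and the question holds for $I$ (in $R$) if and only if it holds for $\overline I$ (in $\overline R$). -/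

import Mathlib

universe u

namespace Vasconcelos

/-- The depth of a module `M` over a local ring `R`: the supremum of the lengths of the
`M`-regular sequences contained in the maximal ideal. -/
noncomputable def depth (R : Type*) [CommRing R] [IsLocalRing R]
    (M : Type*) [AddCommGroup M] [Module R M] : ℕ∞ :=
  ⨆ (rs : List R) (_ : RingTheory.Sequence.IsRegular M rs)
    (_ : ∀ r ∈ rs, r ∈ IsLocalRing.maximalIdeal R), (rs.length : ℕ∞)

/-- A finitely generated module over a (Noetherian) local ring is Cohen-Macaulay if it is zero or
its depth is equal to the Krull dimension of its support. -/
structure IsCohenMacaulayModule (R : Type*) [CommRing R] [IsLocalRing R]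
    (M : Type*) [AddCommGroup M] [Module R M] : Prop where
  finite : Module.Finite R M
  subsingleton_or_depth_eq :
    Subsingleton M ∨ ((depth R M : ℕ∞) : WithBot ℕ∞) = Module.supportDim R M

/-- A Noetherian local ring that is Cohen-Macaulay as a module over itself. -/
structure IsCohenMacaulayLocalRing (A : Type*) [CommRing A] : Prop extends
    IsLocalRing A, IsNoetherianRing A where
  isCohenMacaulayModule : IsCohenMacaulayModule A A

/-- A Noetherian local ring that has finite injective dimension as a module over itself. -/
structure IsGorensteinLocalRing (A : Type u) [CommRing A] : Prop extends
    IsLocalRing A, IsNoetherianRing A where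
  exists_hasInjectiveDimensionLE :
    ∃ n : ℕ, CategoryTheory.HasInjectiveDimensionLE (ModuleCat.of A A) n

/-- A complete intersection ideal: an ideal generated by a regular sequence of the ring. The empty
sequence is allowed, so the zero ideal of a nonzero ring is a complete intersection. -/
def IsCompleteIntersectionIdeal {A : Type*} [CommRing A] (J : Ideal A) : Prop :=
  ∃ rs : List A, RingTheory.Sequence.IsRegular A rs ∧ J = Ideal.ofList rs

/-- `I` is generically a complete intersection: for each associated prime `p` of `R ⧸ I`, the
localization `I_p` is a complete intersection ideal of `R_p`. -/
def IsGenericallyCompleteIntersection {R : Type*} [CommRing R] (I : Ideal R) : Prop :=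
  ∀ (p : Ideal R) [p.IsPrime], p ∈ associatedPrimes R (R ⧸ I) →
    IsCompleteIntersectionIdeal (I.map (algebraMap R (Localization.AtPrime p)))

/-- The question has a positive answer for the ideal `I` of the regular local ring `R`: if `R ⧸ I`
is Cohen-Macaulay, `I` is generically a complete intersection, and the conormal module `I ⧸ I ^ 2`
is Cohen-Macaulay, then `R ⧸ I` is Gorenstein. -/
def QuestionHolds {R : Type u} [CommRing R] [IsRegularLocalRing R] (I : Ideal R) : Prop :=
  IsCohenMacaulayLocalRing (R ⧸ I) →
  IsGenericallyCompleteIntersection I →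
  IsCohenMacaulayModule R I.Cotangent →
  IsGorensteinLocalRing (R ⧸ I)

end Vasconcelos

/-! ### Regular systems of parameters, and regular local rings as domains. -/

section

open IsLocalRing

/-! Everything rests on one linear form `φ` on the conormal module, with values in `R ⧸ I` and value
`1` at the class of `x`. It splits that class off and makes its span free.

To build `φ`, differentiate with respect to `x`. Complete `x` to a regular system of parameters.
Since `R` contains a field, each truncation `R ⧸ 𝔪 ^ N` has a coefficient field and is a quotient of
a polynomial ring over it. For large `N` the relations lie in a high power of the ideal of the
variables (`exists_mem_pow_of_truncEval_mem`), so the partial derivative in the variable of `x`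
descends to a derivation `R → R ⧸ 𝔪 ^ n` (`exists_derivation_eq_one`). Restricted to `I`, it gives a
form modulo `𝔪 ^ n`; Artin–Rees turns these approximate splittings into an exact one
(`exists_linearMap_eq_one`). No completion is needed.

The equivalence then compares the hypotheses one by one. Write `J` for the image of `I` in `R ⧸
(x)`. The rings `R ⧸ I` and `(R ⧸ (x)) ⧸ J` are isomorphic, which settles Cohen–Macaulayness of the
ring and the Gorenstein property. The form `φ` shows that `x` remains a minimal generator of `I` at
every prime containing `I`, so it can start any regular sequence generating `I` there. Finally `I ⧸
I ^ 2` is the direct sum of `R ⧸ I` and `J ⧸ J ^ 2`; when `J ≠ 0` both summands have the same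
support, so with `R ⧸ I` Cohen–Macaulay the sum is Cohen–Macaulay exactly when `J ⧸ J ^ 2` is. -/

/-- Elements `x` of a local ring form a regular system of parameters if they generate the maximal
ideal and their number is the Krull dimension. -/
structure IsRegularSystem {R : Type*} [CommRing R] [IsLocalRing R] {d : ℕ} (x : Fin d → R) :
    Prop where
  span_range_eq : Ideal.span (Set.range x) = maximalIdeal R
  ringKrullDim_eq : ringKrullDim R = d

namespace IsRegularSystem

variable {R : Type*} [CommRing R] [IsLocalRing R]

theorem mem_maximalIdeal {d : ℕ} {x : Fin d → R} (hx : IsRegularSystem x) (i : Fin d) :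
    x i ∈ maximalIdeal R :=
  hx.span_range_eq ▸ Ideal.subset_span ⟨i, rfl⟩

theorem spanFinrank_span_range_le {S : Type*} [CommRing S] {d : ℕ} (x : Fin d → S) :
    (Ideal.span (Set.range x)).spanFinrank ≤ d := by
  refine (Submodule.spanFinrank_span_le_ncard_of_finite (Set.finite_range x)).trans ?_
  rw [← Set.image_univ]
  exact (Set.ncard_image_le).trans (by simp [Set.ncard_univ])

variable [IsNoetherianRing R]

theorem isRegularLocalRing {d : ℕ} {x : Fin d → R} (hx : IsRegularSystem x) :
    IsRegularLocalRing R := by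
  apply IsRegularLocalRing.of_spanFinrank_maximalIdeal_le
  rw [hx.ringKrullDim_eq, ← hx.span_range_eq]
  exact_mod_cast spanFinrank_span_range_le x

/-- The `d` remaining elements generate the maximal ideal, which bounds the dimension above; killing
one element lowers the dimension by at most one, which bounds it below. -/
theorem quotient {d : ℕ} {x : Fin (d + 1) → R} (hx : IsRegularSystem x)
    [IsLocalRing (R ⧸ Ideal.span {x 0})] :
    IsRegularSystem fun i : Fin d ↦ Ideal.Quotient.mk (Ideal.span {x 0}) (x i.succ) := by
  have hspan : Ideal.span (Set.range fun i : Fin d ↦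
      Ideal.Quotient.mk (Ideal.span {x 0}) (x i.succ)) =
      maximalIdeal (R ⧸ Ideal.span {x 0}) := by
    have h := IsLocalRing.map_maximalIdeal_of_surjective (Ideal.Quotient.mk (Ideal.span {x 0}))
      Ideal.Quotient.mk_surjective
    rw [← h, ← hx.span_range_eq, Ideal.map_span, ← Set.range_comp]
    apply le_antisymm
    · exact Ideal.span_mono (by rintro _ ⟨i, rfl⟩; exact ⟨i.succ, rfl⟩)
    · rw [Ideal.span_le]
      rintro _ ⟨i, rfl⟩
      refine Fin.cases ?_ (fun i ↦ Ideal.subset_span ⟨i, rfl⟩) i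
      have : Ideal.Quotient.mk (Ideal.span {x 0}) (x 0) = 0 :=
        Ideal.Quotient.eq_zero_iff_mem.mpr (Ideal.mem_span_singleton_self _)
      simp [this]
  refine ⟨hspan, le_antisymm ?_ ?_⟩
  · refine (ringKrullDim_le_spanFinrank_maximalIdeal _).trans ?_
    rw [← hspan]
    exact_mod_cast spanFinrank_span_range_le _
  · have h := ringKrullDim_le_ringKrullDim_quotient_add_spanFinrank (Ideal.span {x 0})
      (by rw [IsLocalRing.ringJacobson_eq_maximalIdeal, Ideal.span_singleton_le_iff_mem]
          exact hx.mem_maximalIdeal 0)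
    have h1 : (Ideal.span {x 0}).spanFinrank ≤ 1 := by
      simpa using Submodule.spanFinrank_span_le_ncard_of_finite (R := R) (Set.finite_singleton (x 0))
    rw [hx.ringKrullDim_eq] at h
    have h2 : ((d + 1 : ℕ) : WithBot ℕ∞) ≤ ringKrullDim (R ⧸ Ideal.span {x 0}) + 1 :=
      h.trans (by gcongr; exact_mod_cast h1)
    exact ENat.WithBot.add_le_add_one_right_iff.mp (by simpa using h2)

end IsRegularSystem

theorem isLocalRing_quotient_span_singleton {R : Type*} [CommRing R] [IsLocalRing R] {x : R}
    (hx : x ∈ maximalIdeal R) : IsLocalRing (R ⧸ Ideal.span {x}) := by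
  have : Nontrivial (R ⧸ Ideal.span {x}) := Ideal.Quotient.nontrivial_iff.mpr fun h ↦
    (Ideal.ne_top_iff_one _).mp (maximalIdeal.isMaximal R).ne_top
      ((Ideal.span_singleton_le_iff_mem _).mpr hx (h ▸ Submodule.mem_top))
  exact IsLocalRing.of_surjective' _ Ideal.Quotient.mk_surjective

/-- In a regular local ring, an element of `𝔪 \ 𝔪 ^ 2` is part of a regular system of parameters. -/
theorem exists_isRegularSystem {R : Type*} [CommRing R] [IsRegularLocalRing R] {x : R}
    (hx : x ∈ maximalIdeal R) (hx2 : x ∉ maximalIdeal R ^ 2) :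
    ∃ (d : ℕ) (y : Fin (d + 1) → R), IsRegularSystem y ∧ y 0 = x := by
  have hv : (maximalIdeal R).toCotangent ⟨x, hx⟩ ≠ 0 := by
    rwa [Ne, Ideal.toCotangent_eq_zero]
  have hli : LinearIndepOn (ResidueField R) id {(maximalIdeal R).toCotangent ⟨x, hx⟩} :=
    LinearIndepOn.singleton (v := id) hv
  let B := Module.Basis.extend hli
  have hmem : (maximalIdeal R).toCotangent ⟨x, hx⟩ ∈ hli.extend (Set.subset_univ _) :=
    hli.subset_extend _ rfl
  have : Fintype (hli.extend (Set.subset_univ _)) := FiniteDimensional.fintypeBasisIndex B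
  have hcard := Module.finrank_eq_card_basis B
  have hdim := (IsRegularLocalRing.iff_finrank_cotangentSpace R).mp inferInstance
  obtain ⟨d, hd⟩ : ∃ d, Fintype.card (hli.extend (Set.subset_univ _)) = d + 1 :=
    Nat.exists_eq_succ_of_ne_zero (Fintype.card_pos_iff.mpr ⟨⟨_, hmem⟩⟩).ne'
  let e₀ := Fintype.equivFinOfCardEq hd
  let e := e₀.trans (Equiv.swap (e₀ ⟨_, hmem⟩) 0)
  have he : e.symm 0 = ⟨_, hmem⟩ := by simp [e]
  have key : ∀ i, ∃ y : maximalIdeal R, (maximalIdeal R).toCotangent y = B (e.symm i) ∧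
      (i = 0 → (y : R) = x) := by
    intro i
    by_cases hi : i = 0
    · subst hi
      exact ⟨⟨x, hx⟩, by rw [he, Module.Basis.extend_apply_self], fun _ ↦ rfl⟩
    · obtain ⟨y, hy⟩ := (maximalIdeal R).toCotangent_surjective (B (e.symm i))
      exact ⟨y, hy, fun h ↦ (hi h).elim⟩
  choose y hy hy0 using key
  refine ⟨d, fun i ↦ y i, ⟨?_, ?_⟩, hy0 0 rfl⟩
  · have htop : Submodule.span R (Set.range y) = ⊤ := by
      rw [← CotangentSpace.span_image_eq_top_iff, ← Set.range_comp]
      have : (maximalIdeal R).toCotangent ∘ y = B ∘ e.symm := funext hy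
      rw [this, Set.range_comp, e.symm.surjective.range_eq, Set.image_univ, B.span_eq]
    have := congrArg (Submodule.map (maximalIdeal R).subtype) htop
    rw [Submodule.map_span, Submodule.map_subtype_top, ← Set.range_comp] at this
    exact this
  · rw [← hdim, hcard, hd]

theorem IsRegularLocalRing.quotient_span_singleton {R : Type*} [CommRing R] [IsRegularLocalRing R]
    {x : R} (hx : x ∈ maximalIdeal R) (hx2 : x ∉ maximalIdeal R ^ 2) :
    IsRegularLocalRing (R ⧸ Ideal.span {x}) := by
  obtain ⟨d, y, hy, rfl⟩ := exists_isRegularSystem hx hx2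
  have := isLocalRing_quotient_span_singleton hx
  exact hy.quotient.isRegularLocalRing

/-- Induction on the dimension. Choose `x ∈ 𝔪` outside `𝔪 ^ 2` and all minimal primes. The quotient
by `x` is a domain by induction, so `(x)` is prime; a minimal prime `P ≤ (x)` avoids `x`, hence `P =
xP`, and Nakayama gives `P = 0`. -/
theorem IsRegularLocalRing.isDomain (R : Type*) [CommRing R] [IsRegularLocalRing R] :
    IsDomain R := by
  obtain ⟨n, hn⟩ : ∃ n : ℕ, ringKrullDim R = n := ⟨_, (spanFinrank_maximalIdeal (R := R)).symm⟩
  induction n generalizing R with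
  | zero =>
    have h0 : (maximalIdeal R).spanFinrank = 0 := by
      have := spanFinrank_maximalIdeal (R := R)
      rw [hn] at this
      exact_mod_cast this
    rw [Submodule.spanFinrank_eq_zero_iff_eq_bot (IsNoetherian.noetherian _)] at h0
    have := IsLocalRing.isField_iff_maximalIdeal_eq.mpr h0
    exact this.isDomain
  | succ n ih =>
    have hfin : ({maximalIdeal R ^ 2} ∪ minimalPrimes R : Set (Ideal R)).Finite :=
      (Set.finite_singleton _).union (minimalPrimes.finite_of_isNoetherianRing R)
    have hfr : (maximalIdeal R).spanFinrank = n + 1 := by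
      have := spanFinrank_maximalIdeal (R := R)
      rw [hn] at this
      exact_mod_cast this
    have hbot : maximalIdeal R ≠ ⊥ := by
      intro h
      rw [h, Submodule.spanFinrank_bot] at hfr
      omega
    obtain ⟨x, hx, hxn⟩ : ∃ x ∈ maximalIdeal R,
        x ∉ ⋃ I ∈ ({maximalIdeal R ^ 2} ∪ minimalPrimes R : Set (Ideal R)), (I : Set R) := by
      by_contra! hcon
      -- Prime avoidance tolerates two non-prime ideals; `𝔪 ^ 2` fills both slots.
      obtain ⟨J, hJ, hle⟩ := (Ideal.subset_union_prime_finite hfin (f := id)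
        (maximalIdeal R ^ 2) (maximalIdeal R ^ 2) (by
          rintro i (rfl | hi) h1 h2
          · exact (h1 rfl).elim
          · exact hi.1.1)).mp hcon
      rcases hJ with rfl | hJ
      · apply hbot
        apply Submodule.eq_bot_of_le_smul_of_le_jacobson_bot (maximalIdeal R) _
          (IsNoetherian.noetherian _) _ (maximalIdeal_le_jacobson _)
        simpa [pow_two] using hle
      · have hJ' : J = maximalIdeal R := le_antisymm (le_maximalIdeal hJ.1.1.ne_top) hle
        have hht : J.height = 0 := by
          have := hJ.1.1
          exact Ideal.height_eq_zero_iff.mpr hJ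
        have h1 := maximalIdeal_height_eq_ringKrullDim (R := R)
        rw [← hJ', hht, hn] at h1
        have : (0 : ℕ) = n + 1 := by exact_mod_cast h1
        omega
    simp only [Set.mem_iUnion, not_exists] at hxn
    have hx2 : x ∉ maximalIdeal R ^ 2 := fun h ↦ hxn _ (Or.inl rfl) h
    have := IsRegularLocalRing.quotient_span_singleton hx hx2
    have hd : ringKrullDim (R ⧸ Ideal.span {x}) = n := by
      obtain ⟨d, y, hy, rfl⟩ := exists_isRegularSystem hx hx2
      have h2 := hy.ringKrullDim_eq
      rw [hn] at h2
      have h3 : n + 1 = d + 1 := by exact_mod_cast h2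
      rw [hy.quotient.ringKrullDim_eq]
      simp at h3
      rw [h3]
    have hdom := ih _ hd
    have hprime : (Ideal.span {x}).IsPrime := (Ideal.Quotient.isDomain_iff_prime _).mp hdom
    obtain ⟨P, hP, hPle⟩ := Ideal.exists_minimalPrimes_le (I := (⊥ : Ideal R))
      (J := Ideal.span {x}) bot_le
    have hPp := hP.1.1
    have hxP : x ∉ P := fun h ↦ hxn _ (Or.inr hP) h
    have hPbot : P = ⊥ := by
      apply Submodule.eq_bot_of_le_smul_of_le_jacobson_bot (maximalIdeal R) _
          (IsNoetherian.noetherian _) _ (maximalIdeal_le_jacobson _)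
      intro p hp
      obtain ⟨z, rfl⟩ := Ideal.mem_span_singleton'.mp (hPle hp)
      have hz : z ∈ P := (hPp.mem_or_mem hp).resolve_right hxP
      rw [mul_comm]
      exact Submodule.smul_mem_smul hx hz
    rw [hPbot] at hPp
    exact (IsDomain.of_bot_isPrime R)

end

/-! ### Coefficient fields of truncations. -/

section

open IsLocalRing Polynomial

/-- A subring of `T` that maps bijectively onto `T ⧸ n`. -/
structure Subring.IsCoefficientRing {T : Type*} [CommRing T] (n : Ideal T) (S : Subring T) :
    Prop where
  eq_zero_of_mem : ∀ s ∈ S, s ∈ n → s = 0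
  exists_sub_mem : ∀ t, ∃ s ∈ S, t - s ∈ n

/-- If `u` inverts `t` modulo `n`, the error is killed by the `p`-th power, so `t ^ p * u ^ p = 1`,
and `u ^ p` lies in `S`. -/
theorem Subring.exists_mul_eq_one_of_pow_mem {T : Type*} [CommRing T] {p : ℕ} [Fact p.Prime]
    [CharP T p] {n : Ideal T} [n.IsMaximal] (hn : n ^ 2 = ⊥) (S : Subring T)
    (hS : ∀ t, t ^ p ∈ S) {t : T} (ht : t ∈ S) (htn : t ∉ n) : ∃ s ∈ S, t * s = 1 := by
  have hp : p.Prime := Fact.out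
  obtain ⟨u, hu⟩ := Ideal.IsMaximal.exists_inv (I := n) inferInstance htn
  obtain ⟨i, hi, hui⟩ := hu
  have h1 : (t * u) ^ p = 1 := by
    have hz : i ^ p = 0 := by
      have : i ^ p ∈ n ^ 2 := Ideal.pow_le_pow_right hp.two_le (Ideal.pow_mem_pow hi p)
      rwa [hn] at this
    have h2 : t * u = 1 - i := by rw [← hui]; ring
    rw [h2, sub_pow_char, hz, one_pow, sub_zero]
  refine ⟨t ^ (p - 1) * u ^ p, S.mul_mem (S.pow_mem ht _) (hS u), ?_⟩
  rw [← mul_assoc, ← pow_succ', Nat.sub_add_cancel hp.one_le, ← mul_pow, h1]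

/-- A ring of characteristic `p` with a square-zero maximal ideal has a coefficient field. -/
theorem exists_isCoefficientRing_of_sq_eq_bot {T : Type*} [CommRing T] {p : ℕ} [Fact p.Prime]
    [CharP T p] (n : Ideal T) [n.IsMaximal] (hn : n ^ 2 = ⊥) :
    ∃ S : Subring T, S.IsCoefficientRing n := by
  have hp : p.Prime := Fact.out
  have hpow : ∀ t ∈ n, t ^ p = 0 := fun t ht ↦ by
    have : t ^ p ∈ n ^ 2 := Ideal.pow_le_pow_right hp.two_le (Ideal.pow_mem_pow ht p)
    rwa [hn] at this
  have hbase : (frobenius T p).range ∈ {S : Subring T | (∀ t, t ^ p ∈ S) ∧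
      ∀ s ∈ S, s ∈ n → s = 0} := by
    refine ⟨fun t ↦ ⟨t, rfl⟩, ?_⟩
    rintro _ ⟨t, rfl⟩ ht
    exact hpow t (Ideal.IsPrime.mem_of_pow_mem inferInstance p ht)
  -- Take a maximal subring that contains all `p`-th powers and meets `n` trivially. It is a field,
  -- and any class modulo `n` that it misses would allow it to be enlarged.
  obtain ⟨S, -, hS⟩ := zorn_le_nonempty₀ {S : Subring T | (∀ t, t ^ p ∈ S) ∧
      ∀ s ∈ S, s ∈ n → s = 0} (by
    intro c hc hchain S hSc
    have hmem : ∀ {x}, x ∈ sSup c ↔ ∃ s ∈ c, x ∈ s :=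
      Subring.mem_sSup_of_directedOn ⟨S, hSc⟩ hchain.directedOn
    refine ⟨sSup c, ⟨fun t ↦ hmem.mpr ⟨S, hSc, (hc hSc).1 t⟩, fun s hs hsn ↦ ?_⟩,
      fun z hz ↦ le_sSup hz⟩
    obtain ⟨S', hS', hs'⟩ := hmem.mp hs
    exact (hc hS').2 s hs' hsn) _ hbase
  obtain ⟨⟨hSp, hSn⟩, hmax⟩ := hS
  refine ⟨S, hSn, fun a ↦ ?_⟩
  by_contra! ha
  have : Nontrivial T := ⟨0, 1, fun h ↦ (Ideal.ne_top_iff_one n).mp (Ideal.IsMaximal.ne_top ‹_›)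
    (h ▸ n.zero_mem)⟩
  have hfield : IsField S := by
    refine ⟨⟨0, 1, zero_ne_one⟩, mul_comm, fun {t} ht ↦ ?_⟩
    have htn : (t : T) ∉ n := fun h ↦ ht (Subtype.ext (hSn t t.2 h))
    obtain ⟨s, hs, hts⟩ := S.exists_mul_eq_one_of_pow_mem hn hSp t.2 htn
    exact ⟨⟨s, hs⟩, Subtype.ext hts⟩
  let : Field S := hfield.toField
  let g : S[X] := X ^ p - C ⟨a ^ p, hSp a⟩
  -- A root `b ∈ S` would satisfy `(b - a) ^ p = 0`, so `a` would be congruent to `b` modulo `n`.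
  have hg : Irreducible g := by
    refine X_pow_sub_C_irreducible_of_prime hp fun b hb ↦ ha b b.2 ?_
    have hb' : (b : T) ^ p = a ^ p := congrArg Subtype.val hb
    refine Ideal.IsPrime.mem_of_pow_mem (I := n) inferInstance p ?_
    rw [sub_pow_char, hb', sub_self]
    exact n.zero_mem
  have hga : aeval a g = 0 := by
    simp only [g, map_sub, map_pow, aeval_X, aeval_C]
    exact sub_self _
  -- The polynomials with value in `n` form a proper ideal containing the maximal ideal `(g)`, hence
  -- equal to it, and `g` vanishes at `a`. So `S[a]` still meets `n` trivially.
  have hker : ∀ f : S[X], aeval a f ∈ n → aeval a f = 0 := by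
    intro f hf
    have hmaxi : (Ideal.span {g}).IsMaximal := PrincipalIdealRing.isMaximal_of_irreducible hg
    have hle : Ideal.span {g} ≤ n.comap (aeval a : S[X] →ₐ[S] T) := by
      rw [Ideal.span_singleton_le_iff_mem, Ideal.mem_comap, hga]
      exact n.zero_mem
    have hne : n.comap (aeval a : S[X] →ₐ[S] T) ≠ ⊤ :=
      Ideal.comap_ne_top _ (Ideal.IsMaximal.ne_top ‹_›)
    have hmem : f ∈ Ideal.span {g} := by
      rw [hmaxi.eq_of_le hne hle]
      exact hf
    obtain ⟨q, rfl⟩ := Ideal.mem_span_singleton.mp hmem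
    rw [map_mul, hga, zero_mul]
  let S' : Subring T := (aeval a : S[X] →ₐ[S] T).range.toSubring
  have hle : S ≤ S' := fun s hs ↦ ⟨C ⟨s, hs⟩, aeval_C _ _⟩
  have hS' : S' ≤ S := hmax ⟨fun t ↦ hle (hSp t), by
    rintro _ ⟨f, rfl⟩ hf
    exact hker f hf⟩ hle
  exact ha a (hS' ⟨X, aeval_X _⟩) (by simp)

/-- Induction on the nilpotency exponent. The preimage in `T` of a coefficient ring of `T ⧸ n ^ (N +
1)` has a square-zero maximal ideal, so the square-zero case applies to it. -/
theorem exists_isCoefficientRing_of_pow_eq_bot {p : ℕ} [Fact p.Prime] (N : ℕ) {T : Type*}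
    [CommRing T] (hpT : (p : T) = 0) (n : Ideal T) [hmax : n.IsMaximal] (hn : n ^ N = ⊥) :
    ∃ S : Subring T, S.IsCoefficientRing n := by
  have hp : p.Prime := Fact.out
  match N with
  | 0 =>
    rw [pow_zero, Ideal.one_eq_top] at hn
    exact (hmax.ne_top (top_le_iff.mp (hn ▸ bot_le))).elim
  | 1 =>
    rw [pow_one] at hn
    exact ⟨⊤, fun s _ hs ↦ by simpa [hn] using hs, fun t ↦ ⟨t, trivial, by simp⟩⟩
  | N + 2 =>
    let q := Ideal.Quotient.mk (n ^ (N + 1))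
    have hqle : n ^ (N + 1) ≤ n := Ideal.pow_le_self (by omega)
    have hker : RingHom.ker q ≤ n := by rwa [Ideal.mk_ker]
    have hmemq : ∀ t, q t ∈ n.map q ↔ t ∈ n := fun t ↦ by
      rw [← Ideal.mem_comap, Ideal.comap_map_of_surjective q Ideal.Quotient.mk_surjective]
      change _ ∈ n ⊔ RingHom.ker q ↔ _
      rw [sup_eq_left.mpr hker]
    have hmaxU : (n.map q).IsMaximal :=
      (Ideal.map_eq_top_or_isMaximal_of_surjective q Ideal.Quotient.mk_surjective hmax).resolve_left
        fun h ↦ (Ideal.ne_top_iff_one n).mp hmax.ne_top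
          ((hmemq 1).mp (h ▸ Submodule.mem_top))
    obtain ⟨S, hS0, hS⟩ := exists_isCoefficientRing_of_pow_eq_bot (N + 1)
      (T := T ⧸ n ^ (N + 1)) (by rw [← map_natCast q, hpT, map_zero]) (n.map q)
      (by rw [← Ideal.map_pow, Ideal.map_quotient_self])
    let T' : Subring T := S.comap q
    let n' : Ideal T' := (n ^ (N + 1)).comap T'.subtype
    have hn'2 : n' ^ 2 = ⊥ := by
      refine eq_bot_iff.mpr ((Ideal.le_comap_pow _ _).trans ?_)
      rw [← pow_mul]
      have : n ^ ((N + 1) * 2) = ⊥ :=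
        eq_bot_iff.mpr ((Ideal.pow_le_pow_right (by omega)).trans hn.le)
      rw [this]
      intro x hx
      exact Subtype.ext (by simpa using hx)
    have hmem' : ∀ x : T', (x : T) ∈ n → x ∈ n' := fun x hx ↦
      (Ideal.Quotient.eq_zero_iff_mem (I := n ^ (N + 1))).mp (hS0 _ x.2 ((hmemq _).mpr hx))
    have hmax' : n'.IsMaximal := by
      refine Ideal.isMaximal_iff.mpr ⟨fun h ↦ (Ideal.ne_top_iff_one n).mp hmax.ne_top (hqle h),
        fun J x hJ hx hxJ ↦ ?_⟩
      have hxn : (x : T) ∉ n := fun h ↦ hx (hmem' x h)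
      obtain ⟨y, i, hi, hyi⟩ := hmax.exists_inv hxn
      obtain ⟨s, hs, hys⟩ := hS (q y)
      obtain ⟨y', rfl⟩ := Ideal.Quotient.mk_surjective s
      have hyy : y - y' ∈ n := (hmemq _).mp (by rw [map_sub]; exact hys)
      have h1 : 1 - (⟨y', hs⟩ : T') * x ∈ n' := by
        apply hmem'
        change 1 - y' * x ∈ n
        have : 1 - y' * x = i + (y - y') * x := by rw [← hyi]; ring
        rw [this]
        exact n.add_mem hi (n.mul_mem_right _ hyy)
      have := J.add_mem (hJ h1) (J.mul_mem_left ⟨y', hs⟩ hxJ)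
      simpa using this
    have : Nontrivial T' := ⟨0, 1, fun h ↦ (Ideal.ne_top_iff_one n').mp hmax'.ne_top
      (h ▸ n'.zero_mem)⟩
    have : CharP T' p := (CharP.charP_iff_prime_eq_zero hp).mpr (Subtype.ext (by simpa using hpT))
    obtain ⟨S₁, hS₁0, hS₁⟩ := exists_isCoefficientRing_of_sq_eq_bot n' hn'2
    refine ⟨S₁.map T'.subtype, ?_, fun t ↦ ?_⟩
    · rintro _ ⟨s, hs, rfl⟩ hsn
      rw [hS₁0 s hs (hmem' s hsn), map_zero]
    · obtain ⟨s, hs, hts⟩ := hS (q t)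
      obtain ⟨s', rfl⟩ := Ideal.Quotient.mk_surjective s
      obtain ⟨s₁, hs₁, hss⟩ := hS₁ ⟨s', hs⟩
      refine ⟨s₁, ⟨s₁, hs₁, rfl⟩, ?_⟩
      have h1 : t - s' ∈ n := (hmemq _).mp (by rw [map_sub]; exact hts)
      have h2 : s' - s₁ ∈ n := hqle hss
      simpa using n.add_mem h1 h2

theorem Algebra.FormallySmooth.of_charZero (k K : Type*) [Field k] [CharZero k] [Field K]
    [Algebra k K] : Algebra.FormallySmooth k K := by
  obtain ⟨s, hs⟩ := exists_isTranscendenceBasis k K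
  have : Algebra.IsAlgebraic (IntermediateField.adjoin k (Set.range ((↑) : s → K))) K :=
    hs.isAlgebraic_field
  exact .of_algebraicIndependent_of_isSeparable hs.1

/-- A surjection with nilpotent kernel from a ring containing a field onto a field has a section. -/
theorem exists_ringHom_comp_eq_id {T K : Type*} [CommRing T] [Field K] (f : T →+* K)
    (hf : Function.Surjective f) {N : ℕ} (hN : RingHom.ker f ^ N = ⊥)
    {k : Type*} [Field k] (i : k →+* T) : ∃ σ : K →+* T, f.comp σ = RingHom.id K := by
  have hker : (RingHom.ker f).IsMaximal := RingHom.ker_isMaximal_of_surjective f hf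
  obtain _ | ⟨p, _, _⟩ := CharP.exists' k
  · let : Algebra k T := i.toAlgebra
    let : Algebra k K := (f.comp i).toAlgebra
    have := Algebra.FormallySmooth.of_charZero k K
    let fA : T →ₐ[k] K := { f with commutes' := fun _ ↦ rfl }
    let σ := Algebra.FormallySmooth.liftOfSurjective (AlgHom.id k K) fA hf ⟨N, hN⟩
    exact ⟨σ, RingHom.ext fun x ↦
      Algebra.FormallySmooth.liftOfSurjective_apply (AlgHom.id k K) fA hf ⟨N, hN⟩ x⟩
  · obtain ⟨S, hS0, hS⟩ := exists_isCoefficientRing_of_pow_eq_bot (p := p) N (T := T)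
      (by rw [← map_natCast i, CharP.cast_eq_zero, map_zero]) (RingHom.ker f) hN
    have hbij : Function.Bijective (f.comp S.subtype) := by
      refine ⟨(injective_iff_map_eq_zero _).mpr fun s hs ↦ Subtype.ext (hS0 s s.2 hs), fun c ↦ ?_⟩
      obtain ⟨t, rfl⟩ := hf c
      obtain ⟨s, hs, hts⟩ := hS t
      rw [RingHom.mem_ker, map_sub, sub_eq_zero] at hts
      exact ⟨⟨s, hs⟩, hts.symm⟩
    let e := RingEquiv.ofBijective _ hbij
    exact ⟨S.subtype.comp e.symm.toRingHom, RingHom.ext fun x ↦ e.apply_symm_apply x⟩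

/-- The truncations `R ⧸ 𝔪 ^ N` of a local ring containing a field have coefficient fields. -/
theorem IsLocalRing.exists_ringHom_residueField {R : Type*} [CommRing R] [IsLocalRing R]
    (h : ∃ k : Subring R, IsField k) (N : ℕ) :
    ∃ σ : ResidueField R →+* R ⧸ maximalIdeal R ^ N, ∀ r : R,
      Ideal.Quotient.mk _ r - σ (residue R r) ∈
        (maximalIdeal R).map (Ideal.Quotient.mk (maximalIdeal R ^ N)) := by
  obtain ⟨k, hk⟩ := h
  obtain rfl | hN := eq_or_ne N 0
  · have hsub : Subsingleton (R ⧸ maximalIdeal R ^ 0) := by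
      rw [pow_zero, Ideal.one_eq_top]
      infer_instance
    exact ⟨⟨⟨⟨fun _ ↦ 0, Subsingleton.elim _ _⟩, fun _ _ ↦ Subsingleton.elim _ _⟩,
      Subsingleton.elim _ _, fun _ _ ↦ Subsingleton.elim _ _⟩, fun r ↦ by
        rw [Subsingleton.elim (_ - _) 0]; exact Ideal.zero_mem _⟩
  let : Field k := hk.toField
  let f : R ⧸ maximalIdeal R ^ N →+* ResidueField R :=
    Ideal.Quotient.factor (Ideal.pow_le_self hN)
  have hf : ∀ r, f (Ideal.Quotient.mk _ r) = residue R r := fun r ↦ rfl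
  have hker : RingHom.ker f = (maximalIdeal R).map (Ideal.Quotient.mk (maximalIdeal R ^ N)) := by
    ext t
    obtain ⟨r, rfl⟩ := Ideal.Quotient.mk_surjective t
    rw [RingHom.mem_ker, hf, residue_eq_zero_iff, Ideal.mem_quotient_iff_mem (Ideal.pow_le_self hN)]
  obtain ⟨σ, hσ⟩ := exists_ringHom_comp_eq_id f
    (Ideal.Quotient.factor_surjective _) (N := N)
    (by rw [hker, ← Ideal.map_pow, Ideal.map_quotient_self])
    ((Ideal.Quotient.mk (maximalIdeal R ^ N)).comp k.subtype)
  refine ⟨σ, fun r ↦ ?_⟩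
  rw [← hker, RingHom.mem_ker, map_sub, hf]
  have := RingHom.congr_fun hσ (residue R r)
  simp only [RingHom.comp_apply, RingHom.id_apply] at this
  rw [this, sub_self]

end

/-! ### Analytic independence and differentiation with respect to a parameter. -/

section

open IsLocalRing

namespace IsRegularSystem

variable {R : Type u} [CommRing R] [IsLocalRing R] {k : Type*} [Field k]

/-- Evaluation of polynomials over `k` at the elements `x` of `R`, modulo a power of `𝔪`. -/
noncomputable def truncEval {d N : ℕ} (σ : k →+* R ⧸ maximalIdeal R ^ N) (x : Fin d → R) :
    MvPolynomial (Fin d) k →+* R ⧸ maximalIdeal R ^ N :=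
  MvPolynomial.eval₂Hom σ fun i ↦ Ideal.Quotient.mk _ (x i)

theorem map_truncEval_le {d N : ℕ} (σ : k →+* R ⧸ maximalIdeal R ^ N) {x : Fin d → R}
    (hx : ∀ i, x i ∈ maximalIdeal R) (j : ℕ) :
    ((Ideal.span (Set.range MvPolynomial.X)) ^ j).map (truncEval σ x) ≤
      (maximalIdeal R ^ j).map (Ideal.Quotient.mk (maximalIdeal R ^ N)) := by
  rw [Ideal.map_pow, Ideal.map_pow]
  refine Ideal.pow_right_mono ?_ j
  rw [Ideal.map_span, Ideal.span_le]
  rintro _ ⟨_, ⟨i, rfl⟩, rfl⟩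
  simp only [truncEval, MvPolynomial.coe_eval₂Hom, MvPolynomial.eval₂_X]
  exact Ideal.mem_map_of_mem _ (hx i)

theorem exists_eq_rename_add_X_mul {d : ℕ} (F : MvPolynomial (Fin (d + 1)) k) :
    ∃ G, F = MvPolynomial.rename Fin.succ
      (MvPolynomial.aeval (Fin.cons 0 MvPolynomial.X : Fin (d + 1) → MvPolynomial (Fin d) k) F) +
        MvPolynomial.X 0 * G := by
  induction F using MvPolynomial.induction_on with
  | C a => exact ⟨0, by simp⟩
  | add p q hp hq =>
    obtain ⟨G, hG⟩ := hp
    obtain ⟨H, hH⟩ := hq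
    refine ⟨G + H, ?_⟩
    rw [map_add, map_add]
    nth_rewrite 1 [hG, hH]
    ring
  | mul_X p i hp =>
    obtain ⟨G, hG⟩ := hp
    refine Fin.cases ⟨p, ?_⟩ (fun i ↦ ⟨G * MvPolynomial.X i.succ, ?_⟩) i
    · simp [mul_comm]
    · rw [map_mul, map_mul, MvPolynomial.aeval_X, Fin.cons_succ, MvPolynomial.rename_X]
      nth_rewrite 1 [hG]
      ring

end IsRegularSystem

/-- Artin–Rees for `(x)`: multiplication by `x` raises the `I`-adic order by a bounded amount. -/
theorem Ideal.exists_forall_mul_mem_pow {R : Type*} [CommRing R] [IsNoetherianRing R] [IsDomain R]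
    (I : Ideal R) {x : R} (hx : x ≠ 0) :
    ∃ c, ∀ L y, x * y ∈ I ^ (L + c) → y ∈ I ^ L := by
  obtain ⟨c, hc⟩ := Ideal.exists_pow_inf_eq_pow_smul I (Ideal.span {x})
  refine ⟨c, fun L y hy ↦ ?_⟩
  have h1 : x * y ∈ I ^ (L + c) • (⊤ : Ideal R) ⊓ Ideal.span {x} :=
    ⟨by simpa using hy, Ideal.mem_span_singleton.mpr (dvd_mul_right _ _)⟩
  rw [hc _ (Nat.le_add_left _ _), Nat.add_sub_cancel] at h1
  have h2 : x * y ∈ I ^ L * Ideal.span {x} := Ideal.mul_mono_right inf_le_right h1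
  obtain ⟨z, hz, hzx⟩ := Ideal.mem_mul_span_singleton.mp h2
  rw [mul_comm z] at hzx
  rwa [← mul_left_cancel₀ hx hzx]

namespace IsRegularSystem

/-- A regular system of parameters is analytically independent over a coefficient field. -/
theorem exists_mem_pow_of_truncEval_mem {k : Type*} [Field k] {d : ℕ} {R : Type u} [CommRing R]
    [IsLocalRing R] [IsNoetherianRing R] {x : Fin d → R} (hx : IsRegularSystem x) (n : ℕ) :
    ∃ N, ∀ N', N ≤ N' → ∀ (σ : k →+* R ⧸ maximalIdeal R ^ N') (F : MvPolynomial (Fin d) k),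
      truncEval σ x F ∈ (maximalIdeal R ^ N).map (Ideal.Quotient.mk (maximalIdeal R ^ N')) →
        F ∈ Ideal.span (Set.range MvPolynomial.X) ^ n := by
  induction d generalizing R n with
  | zero =>
    -- With no variables `𝔪 = 0`; exponent `1` keeps the truncation nonzero, so that `σ` is
    -- injective on constants.
    refine ⟨1, fun N' hN' σ F hF ↦ ?_⟩
    have hbot : maximalIdeal R = ⊥ := by
      rw [← hx.span_range_eq, Set.range_eq_empty, Ideal.span_empty]
    have : Nontrivial (R ⧸ maximalIdeal R ^ N') := Ideal.Quotient.nontrivial_iff.mpr fun h ↦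
      (maximalIdeal.isMaximal R).ne_top
        (top_le_iff.mp (h ▸ Ideal.pow_le_self (Nat.one_le_iff_ne_zero.mp hN')))
    obtain ⟨c, rfl⟩ := MvPolynomial.C_surjective (Fin 0) F
    rw [pow_one, (congrArg (Ideal.map _) hbot).trans Ideal.map_bot, Ideal.mem_bot] at hF
    simp only [truncEval, MvPolynomial.coe_eval₂Hom, MvPolynomial.eval₂_C, map_eq_zero] at hF
    rw [hF, map_zero]
    exact Ideal.zero_mem _
  | succ d ihd =>
    have := isLocalRing_quotient_span_singleton (hx.mem_maximalIdeal 0)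
    have hreg := hx.isRegularLocalRing
    have hdom := IsRegularLocalRing.isDomain R
    have hx0 : x 0 ≠ 0 := by
      intro h0
      have h1 := hx.quotient.ringKrullDim_eq
      rw [ringKrullDim_eq_of_ringEquiv
        ((Ideal.quotEquivOfEq (by rw [h0]; simp)).trans (RingEquiv.quotientBot R)),
        hx.ringKrullDim_eq] at h1
      have : d + 1 = d := by exact_mod_cast h1
      omega
    obtain ⟨c, hc⟩ := (maximalIdeal R).exists_forall_mul_mem_pow hx0
    induction n with
    | zero => exact ⟨0, fun _ _ _ _ _ ↦ by simp⟩
    | succ n ihn =>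
      obtain ⟨N₁, hN₁⟩ := ihn
      obtain ⟨N₂, hN₂⟩ := ihd hx.quotient (N₁ + c + (n + 1))
      -- `N₁` serves the cofactor `G` at exponent `n`, `c` is the loss in cancelling `x 0`, `n + 1`
      -- is the target exponent, and `N₂` serves the polynomial in one variable fewer.
      refine ⟨N₁ + c + (n + 1) + N₂, fun N' hN' σ F hF ↦ ?_⟩
      set S := R ⧸ Ideal.span {x 0}
      have hmS : maximalIdeal R ≤
          (maximalIdeal S).comap (Ideal.Quotient.mk (Ideal.span {x 0})) := by
        rw [← IsLocalRing.map_maximalIdeal_of_surjective (Ideal.Quotient.mk (Ideal.span {x 0}))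
          Ideal.Quotient.mk_surjective]
        exact Ideal.le_comap_map
      let π : R ⧸ maximalIdeal R ^ N' →+* S ⧸ maximalIdeal S ^ N' :=
        Ideal.quotientMap _ (Ideal.Quotient.mk (Ideal.span {x 0}))
          ((Ideal.pow_right_mono hmS N').trans (Ideal.le_comap_pow _ _))
      -- Write `F = F₀ + X₀ G` with `F₀` free of `X₀`. Modulo `x 0`, induction on `d` puts `F₀` in a
      -- high power of the variables. Then `x 0` times the value of `G` has high order, `x 0`
      -- cancels by Artin–Rees, and induction on `n` handles `G`.
      let F₀ := MvPolynomial.aeval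
        (Fin.cons 0 MvPolynomial.X : Fin (d + 1) → MvPolynomial (Fin d) k) F
      obtain ⟨G, hG⟩ := exists_eq_rename_add_X_mul F
      have hπ : truncEval (π.comp σ)
          (fun i : Fin d ↦ Ideal.Quotient.mk (Ideal.span {x 0}) (x i.succ)) F₀ =
          π (truncEval σ x F) := by
        have : (truncEval (π.comp σ)
            (fun i : Fin d ↦ Ideal.Quotient.mk (Ideal.span {x 0}) (x i.succ))).comp
            (MvPolynomial.aeval (Fin.cons 0 MvPolynomial.X :
              Fin (d + 1) → MvPolynomial (Fin d) k) :
                MvPolynomial (Fin (d + 1)) k →ₐ[k] _).toRingHom = π.comp (truncEval σ x) := by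
          apply MvPolynomial.ringHom_ext
          · intro r
            simp [truncEval]
          · intro i
            refine Fin.cases ?_ (fun i ↦ ?_) i
            · have : Ideal.Quotient.mk (Ideal.span {x 0}) (x 0) = 0 :=
                Ideal.Quotient.eq_zero_iff_mem.mpr (Ideal.mem_span_singleton_self _)
              simp [truncEval, π, this]
            · simp [truncEval, π]
        exact RingHom.congr_fun this F
      have hF₀ : F₀ ∈ Ideal.span (Set.range MvPolynomial.X) ^ (N₁ + c + (n + 1)) := by
        refine hN₂ N' (by omega) (π.comp σ) F₀ ?_
        rw [hπ, ← Ideal.mem_comap]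
        refine Ideal.map_le_iff_le_comap.mpr (fun r hr ↦ ?_) hF
        simp only [Ideal.mem_comap, π, Ideal.quotientMap_mk]
        refine Ideal.mem_map_of_mem _ (?_ : r ∈ (maximalIdeal S ^ N₂).comap _)
        exact (Ideal.pow_right_mono hmS N₂).trans (Ideal.le_comap_pow _ _)
          (Ideal.pow_le_pow_right (by omega) hr)
      have hF₀' : truncEval σ x (MvPolynomial.rename Fin.succ F₀) ∈
          (maximalIdeal R ^ (N₁ + c + (n + 1))).map (Ideal.Quotient.mk _) := by
        have h1 : truncEval σ x (MvPolynomial.rename Fin.succ F₀) =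
            truncEval σ (fun i : Fin d ↦ x i.succ) F₀ := by
          simp only [truncEval, MvPolynomial.coe_eval₂Hom, MvPolynomial.eval₂_rename]
          rfl
        rw [h1]
        exact map_truncEval_le σ (fun i ↦ hx.mem_maximalIdeal i.succ) _
          (Ideal.mem_map_of_mem _ hF₀)
      obtain ⟨y, hy⟩ := Ideal.Quotient.mk_surjective (truncEval σ x G)
      have hxy : Ideal.Quotient.mk (maximalIdeal R ^ N') (x 0 * y) ∈
          (maximalIdeal R ^ (N₁ + c + (n + 1))).map (Ideal.Quotient.mk (maximalIdeal R ^ N')) := by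
        have h1 : Ideal.Quotient.mk (maximalIdeal R ^ N') (x 0 * y) =
            truncEval σ x F - truncEval σ x (MvPolynomial.rename Fin.succ F₀) := by
          have h2 := congrArg (truncEval σ x) hG
          rw [map_add, map_mul] at h2
          rw [map_mul, hy, h2, add_sub_cancel_left]
          simp [truncEval]
        rw [h1]
        exact Ideal.sub_mem _ (Ideal.map_mono (Ideal.pow_le_pow_right (by omega)) hF) hF₀'
      rw [Ideal.mem_quotient_iff_mem (Ideal.pow_le_pow_right (by omega))] at hxy
      have hy1 : y ∈ maximalIdeal R ^ N₁ :=
        hc _ _ (Ideal.pow_le_pow_right (by omega) hxy)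
      have hGn := hN₁ N' (by omega) σ G (hy ▸ Ideal.mem_map_of_mem _ hy1)
      rw [hG]
      refine Ideal.add_mem _ ?_ ?_
      · have h1 : (Ideal.span (Set.range MvPolynomial.X)).map
            (MvPolynomial.rename Fin.succ : MvPolynomial (Fin d) k →ₐ[k] _) ≤
            Ideal.span (Set.range MvPolynomial.X) := by
          rw [Ideal.map_span, Ideal.span_le]
          rintro _ ⟨_, ⟨i, rfl⟩, rfl⟩
          rw [MvPolynomial.rename_X]
          exact Ideal.subset_span ⟨_, rfl⟩
        have h2 := Ideal.mem_map_of_mem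
          (MvPolynomial.rename Fin.succ : MvPolynomial (Fin d) k →ₐ[k] _) hF₀
        rw [Ideal.map_pow] at h2
        exact Ideal.pow_le_pow_right (by omega) (Ideal.pow_right_mono h1 _ h2)
      · rw [pow_succ']
        exact Ideal.mul_mem_mul (Ideal.subset_span ⟨0, rfl⟩) hGn

/-- Successive approximation: subtract a coefficient, expand the remainder in the `x i`, and
approximate the new coefficients. The process ends because the maximal ideal of the truncation is
nilpotent. -/
theorem truncEval_surjective {R : Type u} [CommRing R] [IsLocalRing R] {k : Type*} [Field k]
    {d N : ℕ} {x : Fin d → R} (hx : Ideal.span (Set.range x) = maximalIdeal R)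
    (σ : k →+* R ⧸ maximalIdeal R ^ N)
    (hσ : ∀ r : R, ∃ c : k, Ideal.Quotient.mk _ r - σ c ∈
      (maximalIdeal R).map (Ideal.Quotient.mk (maximalIdeal R ^ N))) :
    Function.Surjective (truncEval σ x) := by
  have key : ∀ j : ℕ, ∀ t, ∃ p, t - truncEval σ x p ∈
      (maximalIdeal R).map (Ideal.Quotient.mk (maximalIdeal R ^ N)) ^ j := by
    intro j
    induction j with
    | zero => exact fun t ↦ ⟨0, by simp⟩
    | succ j ih =>
      intro t
      obtain ⟨r, rfl⟩ := Ideal.Quotient.mk_surjective t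
      obtain ⟨c, hc⟩ := hσ r
      rw [(congrArg (Ideal.map _) hx.symm).trans (Ideal.map_span _ _), ← Set.range_comp,
        Ideal.mem_span_range_iff_exists_fun] at hc
      obtain ⟨a, ha⟩ := hc
      choose p hp using fun i ↦ ih (a i)
      refine ⟨MvPolynomial.C c + ∑ i, p i * MvPolynomial.X i, ?_⟩
      have : Ideal.Quotient.mk _ r - truncEval σ x (MvPolynomial.C c + ∑ i, p i * MvPolynomial.X i)
          = ∑ i, (a i - truncEval σ x (p i)) * Ideal.Quotient.mk _ (x i) := by
        simp only [map_add, map_sum, map_mul, sub_mul, Finset.sum_sub_distrib]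
        simp only [Function.comp_apply] at ha
        rw [ha]
        simp [truncEval]
        ring
      rw [this]
      refine Ideal.sum_mem _ fun i _ ↦ ?_
      rw [pow_succ]
      exact Ideal.mul_mem_mul (hp i)
        (Ideal.mem_map_of_mem _ (hx ▸ Ideal.subset_span ⟨i, rfl⟩))
  intro t
  obtain ⟨p, hp⟩ := key N t
  rw [← Ideal.map_pow, Ideal.map_quotient_self, Ideal.mem_bot, sub_eq_zero] at hp
  exact ⟨p, hp.symm⟩

end IsRegularSystem

theorem Derivation.mem_pow_of_mem_pow_succ {k P : Type*} [CommRing k] [CommRing P] [Algebra k P]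
    (D : Derivation k P P) (I : Ideal P) (n : ℕ) {q : P} (hq : q ∈ I ^ (n + 1)) :
    D q ∈ I ^ n := by
  induction n generalizing q with
  | zero => simp
  | succ n ih =>
    rw [pow_succ'] at hq
    refine Submodule.mul_induction_on hq (fun a ha b hb ↦ ?_) fun a b ha hb ↦ ?_
    · rw [D.leibniz, smul_eq_mul, smul_eq_mul]
      refine Ideal.add_mem _ ?_ (Ideal.mul_mem_right _ _ hb)
      rw [pow_succ']
      exact Ideal.mul_mem_mul ha (ih hb)
    · rw [map_add]
      exact Ideal.add_mem _ ha hb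

/-- In a regular local ring containing a field, an element of `𝔪 \ 𝔪 ^ 2` can be differentiated
with respect to, modulo any power of `𝔪`. -/
theorem IsRegularLocalRing.exists_derivation_eq_one {R : Type u} [CommRing R]
    [IsRegularLocalRing R] (hfield : ∃ k : Subring R, IsField k) {x : R}
    (hx : x ∈ maximalIdeal R) (hx2 : x ∉ maximalIdeal R ^ 2) (n : ℕ) :
    ∃ D : Derivation ℤ R (R ⧸ maximalIdeal R ^ n), D x = 1 := by
  obtain ⟨d, y, hy, rfl⟩ := exists_isRegularSystem hx hx2
  obtain ⟨N, hN⟩ := hy.exists_mem_pow_of_truncEval_mem (k := ResidueField R) (n + 1)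
  -- The exponent must be at least `N` for independence and at least `n` for the projection `ρ`.
  obtain ⟨σ, hσ⟩ := IsLocalRing.exists_ringHom_residueField hfield (N + n)
  have hsurj := IsRegularSystem.truncEval_surjective hy.span_range_eq σ fun r ↦ ⟨_, hσ r⟩
  let ρ : R ⧸ maximalIdeal R ^ (N + n) →+* R ⧸ maximalIdeal R ^ n :=
    Ideal.Quotient.factor (Ideal.pow_le_pow_right (Nat.le_add_left _ _))
  let ψ := ρ.comp (IsRegularSystem.truncEval σ y)
  have hψ : ∀ q, IsRegularSystem.truncEval σ y q = 0 → ψ (MvPolynomial.pderiv 0 q) = 0 := by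
    intro q hq
    have h1 := (MvPolynomial.pderiv 0).mem_pow_of_mem_pow_succ _ n
      (hN (N + n) (Nat.le_add_right _ _) σ q (by rw [hq]; exact Ideal.zero_mem _))
    have h2 := IsRegularSystem.map_truncEval_le σ hy.mem_maximalIdeal n
      (Ideal.mem_map_of_mem _ h1)
    have h3 := Ideal.mem_map_of_mem ρ h2
    rw [Ideal.map_map] at h3
    have h4 : ρ.comp (Ideal.Quotient.mk (maximalIdeal R ^ (N + n))) =
      Ideal.Quotient.mk (maximalIdeal R ^ n) := RingHom.ext fun r ↦ rfl
    rw [h4, Ideal.map_quotient_self] at h3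
    exact h3
  choose p hp using fun r : R ↦ hsurj (Ideal.Quotient.mk _ r)
  -- The value does not depend on the polynomial lift, so sums and products of lifts yield
  -- additivity and the Leibniz rule.
  have hD : ∀ r q, IsRegularSystem.truncEval σ y q = Ideal.Quotient.mk _ r →
      ψ (MvPolynomial.pderiv 0 (p r)) = ψ (MvPolynomial.pderiv 0 q) := by
    intro r q hq
    rw [← sub_eq_zero, ← map_sub, ← map_sub]
    exact hψ _ (by rw [map_sub, hp, hq, sub_self])
  have hψp : ∀ r, ψ (p r) = Ideal.Quotient.mk _ r := fun r ↦ by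
    change ρ (IsRegularSystem.truncEval σ y (p r)) = _
    rw [hp]
    rfl
  let D₀ : R →+ R ⧸ maximalIdeal R ^ n :=
    AddMonoidHom.mk' (fun r ↦ ψ (MvPolynomial.pderiv 0 (p r))) fun a b ↦ by
      rw [hD (a + b) (p a + p b) (by rw [map_add, hp, hp, map_add]), map_add, map_add]
  refine ⟨Derivation.mk' D₀.toIntLinearMap fun a b ↦ ?_, ?_⟩
  · change ψ (MvPolynomial.pderiv 0 (p (a * b))) = a • ψ (MvPolynomial.pderiv 0 (p b)) +
      b • ψ (MvPolynomial.pderiv 0 (p a))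
    rw [hD (a * b) (p a * p b) (by rw [map_mul, hp, hp, map_mul]), Derivation.leibniz, map_add,
      smul_eq_mul, smul_eq_mul, map_mul, map_mul, hψp, hψp, Algebra.smul_def, Algebra.smul_def]
    rfl
  · change ψ (MvPolynomial.pderiv 0 (p (y 0))) = 1
    rw [hD (y 0) (MvPolynomial.X 0) (by simp [IsRegularSystem.truncEval]),
      MvPolynomial.pderiv_X_self, map_one]

end

/-! ### From derivations to a splitting of the conormal module. -/

section

open IsLocalRing

/-- Over a Noetherian local ring, a homomorphism `A → M`, `1 ↦ v`, splits as soon as it splits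
modulo all powers of the maximal ideal. -/
theorem IsLocalRing.exists_linearMap_eq_one {A M : Type*} [CommRing A] [IsLocalRing A]
    [IsNoetherianRing A] [AddCommGroup M] [Module A M] [Module.Finite A M] {v : M}
    (h : ∀ n, ∃ φ : M →ₗ[A] A ⧸ maximalIdeal A ^ n, φ v = 1) : ∃ φ : M →ₗ[A] A, φ v = 1 := by
  obtain ⟨q, π, hπ⟩ := Module.Finite.exists_fin' A M
  obtain ⟨p, g, hg⟩ := Submodule.fg_iff_exists_fin_generating_family.mp
    (IsNoetherian.noetherian (LinearMap.ker π))
  -- `T` evaluates a form on the relations of `M`; a form descends to `M` exactly when `T` kills it.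
  let T : ((Fin q → A) →ₗ[A] A) →ₗ[A] (Fin p → A) :=
    LinearMap.pi fun i ↦ LinearMap.applyₗ (g i)
  obtain ⟨c, hc⟩ := (maximalIdeal A).exists_pow_inf_eq_pow_smul (LinearMap.range T)
  obtain ⟨φ, hφ⟩ := h (c + 1)
  obtain ⟨f, hf⟩ := Module.projective_lifting_property
    ((maximalIdeal A ^ (c + 1)).mkQ) (φ ∘ₗ π) (Submodule.mkQ_surjective _)
  have hf' : ∀ w, Ideal.Quotient.mk (maximalIdeal A ^ (c + 1)) (f w) = φ (π w) :=
    fun w ↦ LinearMap.congr_fun hf w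
  have hTf : T f ∈ maximalIdeal A ^ (c + 1) • (⊤ : Submodule A (Fin p → A)) := by
    have hcoord : ∀ i, T f i ∈ maximalIdeal A ^ (c + 1) := fun i ↦ by
      refine Ideal.Quotient.eq_zero_iff_mem.mp ((hf' (g i)).trans ?_)
      have : g i ∈ LinearMap.ker π := hg ▸ Submodule.subset_span ⟨i, rfl⟩
      rw [LinearMap.mem_ker.mp this, map_zero]
    rw [pi_eq_sum_univ' (T f)]
    exact Submodule.sum_mem _ fun i _ ↦ Submodule.smul_mem_smul (hcoord i) trivial
  -- Artin–Rees at exponent `c + 1` leaves one factor of `𝔪`. Hence `f` can be corrected by some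
  -- `f'` in `𝔪 • Hom` to kill all relations, while its value at `w` stays `1` modulo `𝔪`, a unit.
  have hmem : T f ∈ (maximalIdeal A • (⊤ : Submodule A ((Fin q → A) →ₗ[A] A))).map T := by
    have h1 : T f ∈ maximalIdeal A ^ (c + 1) • (⊤ : Submodule A (Fin p → A)) ⊓ LinearMap.range T :=
      ⟨hTf, f, rfl⟩
    rw [hc (c + 1) (Nat.le_succ _), Nat.add_sub_cancel_left, pow_one] at h1
    rw [Submodule.map_smul'', Submodule.map_top]
    exact Submodule.smul_mono le_rfl inf_le_right h1
  obtain ⟨f', hf'm, hTf'⟩ := hmem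
  have hle : LinearMap.ker π ≤ LinearMap.ker (f - f') := by
    rw [← hg, Submodule.span_le]
    rintro _ ⟨i, rfl⟩
    have := congrFun hTf' i
    change f' (g i) = f (g i) at this
    simp [this]
  obtain ⟨w, rfl⟩ := hπ v
  let ψ : M →ₗ[A] A := (LinearMap.ker π).liftQ (f - f') hle ∘ₗ
    (π.quotKerEquivOfSurjective hπ).symm.toLinearMap
  have hψ : ψ (π w) = f w - f' w := by
    have : (π.quotKerEquivOfSurjective hπ).symm (π w) = (LinearMap.ker π).mkQ w := by
      rw [LinearEquiv.symm_apply_eq]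
      rfl
    change (LinearMap.ker π).liftQ (f - f') hle ((π.quotKerEquivOfSurjective hπ).symm (π w)) = _
    rw [this]
    rfl
  have hf'w : f' w ∈ maximalIdeal A := by
    refine Submodule.smul_induction_on hf'm (fun a ha l _ ↦ ?_) fun a b ha hb ↦ ?_
    · exact Ideal.mul_mem_right _ _ ha
    · exact Ideal.add_mem _ ha hb
  have hfw : f w - 1 ∈ maximalIdeal A := by
    refine Ideal.pow_le_self (Nat.succ_ne_zero c) ?_
    rw [← Ideal.Quotient.eq_zero_iff_mem, map_sub, hf', hφ, map_one, sub_self]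
  have hunit : IsUnit (ψ (π w)) := by
    by_contra hcon
    refine (Ideal.ne_top_iff_one (maximalIdeal A)).mp (maximalIdeal.isMaximal A).ne_top ?_
    have h1 : ψ (π w) ∈ maximalIdeal A := (mem_maximalIdeal _).mpr hcon
    have : (1 : A) = ψ (π w) + f' w - (f w - 1) := by rw [hψ]; ring
    rw [this]
    exact Ideal.sub_mem _ (Ideal.add_mem _ h1 hf'w) hfw
  obtain ⟨u, hu⟩ := hunit
  exact ⟨(↑u⁻¹ : A) • ψ, by rw [LinearMap.smul_apply, ← hu, smul_eq_mul, Units.inv_mul]⟩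

/-- A derivation of `R` into an `R ⧸ I`-module induces a linear map on the conormal module. -/
theorem Derivation.exists_cotangent_linearMap {R : Type*} [CommRing R] (I : Ideal R) {N : Type*}
    [AddCommGroup N] [Module R N] [Module (R ⧸ I) N] [IsScalarTower R (R ⧸ I) N]
    (D : Derivation ℤ R N) :
    ∃ φ : I.Cotangent →ₗ[R ⧸ I] N, ∀ a : I, φ (I.toCotangent a) = D a := by
  have hI : ∀ a ∈ I, ∀ y : N, a • y = 0 := fun a ha y ↦ by
    rw [← algebraMap_smul (R ⧸ I) a y, Ideal.Quotient.algebraMap_eq,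
      Ideal.Quotient.eq_zero_iff_mem.mpr ha, zero_smul]
  let φ₀ : I →ₗ[R] N :=
    { toFun := fun a ↦ D a
      map_add' := fun a b ↦ map_add D _ _
      map_smul' := fun r a ↦ by
        simp only [SetLike.val_smul, smul_eq_mul, D.leibniz, hI _ a.2, add_zero, RingHom.id_apply] }
  have hle : I • (⊤ : Submodule R I) ≤ LinearMap.ker φ₀ := by
    rw [Submodule.smul_le]
    intro r hr a _
    exact (φ₀.map_smul r a).trans (hI r hr _)
  let φ₁ : I.Cotangent →ₗ[R] N := (I • (⊤ : Submodule R I)).liftQ φ₀ hle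
  exact ⟨φ₁.extendScalarsOfSurjective Ideal.Quotient.mk_surjective, fun a ↦ rfl⟩

/-- In a regular local ring containing a field, an element of `𝔪 \ 𝔪 ^ 2` lying in `I` spans a free
direct summand of the conormal module of `I`. -/
theorem IsRegularLocalRing.exists_cotangent_linearMap_eq_one {R : Type u} [CommRing R]
    [IsRegularLocalRing R] (hfield : ∃ k : Subring R, IsField k) (I : Ideal R) {x : R}
    (hxI : x ∈ I) (hx : x ∈ maximalIdeal R) (hx2 : x ∉ maximalIdeal R ^ 2) :
    ∃ φ : I.Cotangent →ₗ[R ⧸ I] R ⧸ I, φ (I.toCotangent ⟨x, hxI⟩) = 1 := by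
  by_cases hI : I = ⊤
  · have : Subsingleton (R ⧸ I) := Ideal.Quotient.subsingleton_iff.mpr hI
    exact ⟨0, Subsingleton.elim _ _⟩
  have : Nontrivial (R ⧸ I) := Ideal.Quotient.nontrivial_iff.mpr hI
  have : IsLocalRing (R ⧸ I) := IsLocalRing.of_surjective' _ Ideal.Quotient.mk_surjective
  have : Module.Finite R I.Cotangent := Module.Finite.of_surjective _ I.toCotangent_surjective
  have : Module.Finite (R ⧸ I) I.Cotangent := Module.Finite.of_restrictScalars_finite R _ _
  refine IsLocalRing.exists_linearMap_eq_one fun n ↦ ?_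
  obtain ⟨D, hD⟩ := IsRegularLocalRing.exists_derivation_eq_one hfield hx hx2 n
  have hle : maximalIdeal R ^ n ≤
      LinearMap.ker (((maximalIdeal (R ⧸ I) ^ n).mkQ.restrictScalars R) ∘ₗ I.mkQ) := by
    intro r hr
    refine (Ideal.Quotient.eq_zero_iff_mem (I := maximalIdeal (R ⧸ I) ^ n)).mpr ?_
    rw [← IsLocalRing.map_maximalIdeal_of_surjective (Ideal.Quotient.mk I)
      Ideal.Quotient.mk_surjective, ← Ideal.map_pow]
    exact Ideal.mem_map_of_mem _ hr
  -- Composing with `θ` makes the target an `R ⧸ I`-module, as needed for the derivation to be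
  -- linear on `I` and vanish on `I ^ 2`.
  let θ : (R ⧸ maximalIdeal R ^ n) →ₗ[R] (R ⧸ I) ⧸ maximalIdeal (R ⧸ I) ^ n :=
    (maximalIdeal R ^ n).liftQ _ hle
  obtain ⟨φ, hφ⟩ := (θ.compDer D).exists_cotangent_linearMap I
  refine ⟨φ, (hφ _).trans ?_⟩
  change θ (D x) = 1
  rw [hD]
  rfl

theorem LinearMap.isCompl_span_singleton_ker {A M : Type*} [CommRing A] [AddCommGroup M]
    [Module A M] {v : M} (φ : M →ₗ[A] A) (hφ : φ v = 1) :
    IsCompl (Submodule.span A {v}) (LinearMap.ker φ) := by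
  constructor
  · rw [Submodule.disjoint_def]
    intro w hw hwk
    obtain ⟨a, rfl⟩ := Submodule.mem_span_singleton.mp hw
    rw [LinearMap.mem_ker, map_smul, hφ, smul_eq_mul, mul_one] at hwk
    rw [hwk, zero_smul]
  · rw [codisjoint_iff, eq_top_iff]
    intro w _
    refine Submodule.mem_sup.mpr ⟨φ w • v, Submodule.smul_mem _ _ (Submodule.mem_span_singleton_self v),
      w - φ w • v, ?_, by abel⟩
    rw [LinearMap.mem_ker, map_sub, map_smul, hφ, smul_eq_mul, mul_one, sub_self]

theorem LinearMap.nonempty_linearEquiv_span_singleton {A M : Type*} [CommRing A] [AddCommGroup M]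
    [Module A M] {v : M} (φ : M →ₗ[A] A) (hφ : φ v = 1) :
    Nonempty (A ≃ₗ[A] Submodule.span A {v}) := by
  have hinj : Function.Injective (LinearMap.toSpanSingleton A M v) := by
    intro a b hab
    have := congrArg φ hab
    simpa [hφ] using this
  exact ⟨(LinearEquiv.ofInjective _ hinj).trans
    (LinearEquiv.ofEq _ _ (LinearMap.range_toSpanSingleton v))⟩

end

/-! ### Cohen–Macaulay modules: change of rings and direct sums. -/

section

open IsLocalRing RingTheory.Sequence

/-- A retract stays a retract modulo `r`, and regularity of one element passes to submodules. -/
theorem RingTheory.Sequence.IsWeaklyRegular.of_retract {R M K : Type*} [CommRing R]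
    [AddCommGroup M] [Module R M] [AddCommGroup K] [Module R K] (i : K →ₗ[R] M) (p : M →ₗ[R] K)
    (hip : p ∘ₗ i = LinearMap.id) {rs : List R} (h : IsWeaklyRegular M rs) :
    IsWeaklyRegular K rs := by
  induction rs generalizing M K with
  | nil => exact .nil R K
  | cons r rs ih =>
    rw [isWeaklyRegular_cons_iff] at h ⊢
    refine ⟨h.1.of_injective i
      (Function.LeftInverse.injective fun w ↦ LinearMap.congr_fun hip w),
      ih (QuotSMulTop.map r i) (QuotSMulTop.map r p) ?_ h.2⟩
    rw [← QuotSMulTop.map_comp, hip, QuotSMulTop.map_id]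

theorem RingTheory.Sequence.IsRegular.length_le_supportDim {R M : Type*} [CommRing R]
    [IsLocalRing R] [IsNoetherianRing R] [AddCommGroup M] [Module R M] [Module.Finite R M]
    {rs : List R} (h : IsRegular M rs) :
    (rs.length : WithBot ℕ∞) ≤ Module.supportDim R M := by
  have := Module.supportDim_add_length_eq_supportDim_of_isRegular rs h
  rw [← this]
  have : Nontrivial (M ⧸ Ideal.ofList rs • (⊤ : Submodule R M)) :=
    h.quot_ofList_smul_nontrivial ⊤
  have h0 : (0 : WithBot ℕ∞) ≤ Module.supportDim R (M ⧸ Ideal.ofList rs • (⊤ : Submodule R M)) := by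
    have := Module.supportDim_ne_bot_of_nontrivial R (M ⧸ Ideal.ofList rs • (⊤ : Submodule R M))
    revert this
    generalize Module.supportDim R (M ⧸ Ideal.ofList rs • (⊤ : Submodule R M)) = D
    intro hD
    obtain ⟨e, rfl⟩ := WithBot.ne_bot_iff_exists.mp hD
    exact_mod_cast zero_le (a := e)
  exact le_add_of_nonneg_left h0

theorem Module.exists_supportDim_eq_natCast (R M : Type*) [CommRing R]
    [IsLocalRing R] [IsNoetherianRing R] [AddCommGroup M] [Module R M] [Nontrivial M] :
    ∃ n : ℕ, Module.supportDim R M = n := by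
  have h1 := Module.supportDim_ne_bot_of_nontrivial R M
  have h2 : Module.supportDim R M < ⊤ :=
    (Module.supportDim_le_ringKrullDim R M).trans_lt ringKrullDim_lt_top
  revert h1 h2
  generalize Module.supportDim R M = D
  intro h1 h2
  obtain ⟨e, rfl⟩ := WithBot.ne_bot_iff_exists.mp h1
  have he : e ≠ ⊤ := by rintro rfl; exact h2.ne rfl
  obtain ⟨n, rfl⟩ := ENat.ne_top_iff_exists.mp he
  exact ⟨n, rfl⟩

namespace Vasconcelos

/-- Lengths of regular sequences are bounded by the finite dimension, so the supremum defining depth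
is attained and can be traded for an actual sequence. -/
theorem isCohenMacaulayModule_iff {R M : Type*} [CommRing R] [IsLocalRing R] [IsNoetherianRing R]
    [AddCommGroup M] [Module R M] [Module.Finite R M] :
    IsCohenMacaulayModule R M ↔ Subsingleton M ∨ ∃ rs : List R, IsRegular M rs ∧
      (∀ r ∈ rs, r ∈ maximalIdeal R) ∧ (rs.length : WithBot ℕ∞) = Module.supportDim R M := by
  constructor
  · rintro ⟨-, h⟩
    rcases subsingleton_or_nontrivial M with hM | hM
    · exact Or.inl hM
    obtain h | h := h
    · exact Or.inl h
    right
    obtain ⟨n, hn⟩ := Module.exists_supportDim_eq_natCast R M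
    rw [hn] at h ⊢
    have hd : depth R M = n := by exact_mod_cast h
    obtain rfl | hn0 := Nat.eq_zero_or_pos n
    · exact ⟨[], IsRegular.nil R M, by simp, rfl⟩
    -- A sequence longer than `n - 1` has length `n`; truncated subtraction is why `n = 0` was
    -- treated apart.
    have hlt : ((n - 1 : ℕ) : ℕ∞) < depth R M := by
      rw [hd]
      exact_mod_cast Nat.sub_lt hn0 one_pos
    simp only [depth, lt_iSup_iff] at hlt
    obtain ⟨rs, hreg, hmem, hlt⟩ := hlt
    refine ⟨rs, hreg, hmem, ?_⟩
    have h1 := hreg.length_le_supportDim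
    rw [hn] at h1
    have h1' : rs.length ≤ n := by exact_mod_cast h1
    have h2 : n - 1 < rs.length := by exact_mod_cast hlt
    exact_mod_cast (by omega : rs.length = n)
  · rintro (h | ⟨rs, hreg, hmem, hlen⟩)
    · exact ⟨inferInstance, Or.inl h⟩
    · refine ⟨inferInstance, Or.inr (le_antisymm ?_ ?_)⟩
      · have : depth R M ≤ rs.length := by
          simp only [depth, iSup_le_iff]
          intro ts hts _
          have h1 := hts.length_le_supportDim
          rw [← hlen] at h1
          exact_mod_cast h1
        rw [← hlen]
        exact_mod_cast this
      · rw [← hlen]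
        have : (rs.length : ℕ∞) ≤ depth R M :=
          le_iSup_of_le rs (le_iSup_of_le hreg (le_iSup_of_le hmem le_rfl))
        exact_mod_cast this

theorem IsCohenMacaulayModule.of_linearEquiv {R M N : Type*} [CommRing R] [IsLocalRing R]
    [IsNoetherianRing R] [AddCommGroup M] [Module R M] [AddCommGroup N] [Module R N]
    (e : M ≃ₗ[R] N) (h : IsCohenMacaulayModule R M) : IsCohenMacaulayModule R N := by
  have := h.finite
  have := Module.Finite.equiv e
  rw [isCohenMacaulayModule_iff] at h ⊢
  refine h.imp e.toEquiv.subsingleton_congr.mp ?_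
  rintro ⟨rs, h1, h2, h3⟩
  exact ⟨rs, (e.isRegular_congr rs).mp h1, h2, h3.trans (Module.supportDim_eq_of_equiv e)⟩

theorem supportDim_eq_of_surjective {R S M : Type*} [CommRing R] [CommRing S] [Algebra R S]
    (hs : Function.Surjective (algebraMap R S)) [AddCommGroup M] [Module R M] [Module S M]
    [IsScalarTower R S M] [Module.Finite R M] :
    Module.supportDim S M = Module.supportDim R M := by
  have : Module.Finite S M := Module.Finite.of_restrictScalars_finite R S M
  rw [Module.supportDim_eq_ringKrullDim_quotient_annihilator,
    Module.supportDim_eq_ringKrullDim_quotient_annihilator]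
  let f : R →+* S ⧸ Module.annihilator S M :=
    (Ideal.Quotient.mk (Module.annihilator S M)).comp (algebraMap R S)
  have hf : Function.Surjective f := Ideal.Quotient.mk_surjective.comp hs
  have hker : RingHom.ker f = Module.annihilator R M := by
    ext r
    rw [RingHom.mem_ker, RingHom.comp_apply, Ideal.Quotient.eq_zero_iff_mem,
      Module.mem_annihilator, Module.mem_annihilator]
    simp
  exact (ringKrullDim_eq_of_ringEquiv ((Ideal.quotEquivOfEq hker.symm).trans
    (RingHom.quotientKerEquivOfSurjective hf))).symm

theorem isCohenMacaulayModule_iff_of_surjective {R S M : Type*} [CommRing R] [IsLocalRing R]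
    [IsNoetherianRing R] [CommRing S] [IsLocalRing S] [Algebra R S]
    (hs : Function.Surjective (algebraMap R S)) [AddCommGroup M] [Module R M] [Module S M]
    [IsScalarTower R S M] [Module.Finite R M] :
    IsCohenMacaulayModule S M ↔ IsCohenMacaulayModule R M := by
  have : Module.Finite S M := Module.Finite.of_restrictScalars_finite R S M
  have : IsNoetherianRing S := isNoetherianRing_of_surjective R S _ hs
  have hmap := IsLocalRing.map_maximalIdeal_of_surjective (algebraMap R S) hs
  have hmem : ∀ r, algebraMap R S r ∈ maximalIdeal S ↔ r ∈ maximalIdeal R := fun r ↦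
    ⟨fun h ↦ (mem_maximalIdeal _).mpr fun hu ↦ (mem_maximalIdeal _).mp h (hu.map _),
      fun h ↦ hmap ▸ Ideal.mem_map_of_mem _ h⟩
  have hreg : ∀ rs : List R, IsRegular M (rs.map (algebraMap R S)) ↔ IsRegular M rs := fun rs ↦
    (AddEquiv.refl M).isRegular_congr <| List.forall₂_map_left_iff.mpr <|
      List.forall₂_same.mpr fun r _ x => algebraMap_smul S r x
  rw [isCohenMacaulayModule_iff, isCohenMacaulayModule_iff, supportDim_eq_of_surjective hs]
  refine or_congr_right ?_
  constructor
  · rintro ⟨rs, h1, h2, h3⟩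
    obtain ⟨ts, rfl⟩ := List.map_surjective_iff.mpr hs rs
    exact ⟨ts, (hreg ts).mp h1, fun r hr ↦ (hmem r).mp (h2 _ (List.mem_map_of_mem hr)),
      by simpa using h3⟩
  · rintro ⟨rs, h1, h2, h3⟩
    refine ⟨rs.map (algebraMap R S), (hreg rs).mpr h1, fun r hr ↦ ?_, by simpa using h3⟩
    obtain ⟨t, ht, rfl⟩ := List.mem_map.mp hr
    exact (hmem t).mpr (h2 t ht)

open CategoryTheory Abelian in
/-- The depth of a direct sum is at least the minimum of the depths. -/
theorem exists_isRegular_prod {R : Type u} [CommRing R] [IsLocalRing R] [IsNoetherianRing R]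
    {A K : Type u} [AddCommGroup A] [Module R A] [AddCommGroup K] [Module R K] [Module.Finite R A]
    [Module.Finite R K] [Nontrivial A] [Nontrivial K] {n : ℕ}
    (hA : ∃ rs : List R, rs.length = n ∧ (∀ r ∈ rs, r ∈ maximalIdeal R) ∧ IsRegular A rs)
    (hK : ∃ rs : List R, rs.length = n ∧ (∀ r ∈ rs, r ∈ maximalIdeal R) ∧ IsRegular K rs) :
    ∃ rs : List R, rs.length = n ∧ (∀ r ∈ rs, r ∈ maximalIdeal R) ∧ IsRegular (A × K) rs := by
  have hlt : ∀ (M : Type u) [AddCommGroup M] [Module R M] [Module.Finite R M] [Nontrivial M],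
      maximalIdeal R • (⊤ : Submodule R M) < ⊤ := fun M _ _ _ _ ↦
    (Submodule.top_ne_ideal_smul_of_le_jacobson_annihilator
      (maximalIdeal_le_jacobson _)).symm.lt_top
  -- The given sequences for `A` and `K` may differ. Vanishing of `Ext` below degree `n` does not
  -- refer to a sequence, and it passes to the middle of the split exact sequence.
  have h1 := (((ModuleCat.of R A).exists_isRegular_tfae (maximalIdeal R) n (hlt A)).out 3 1).mp hA
  have h2 := (((ModuleCat.of R K).exists_isRegular_tfae (maximalIdeal R) n (hlt K)).out 3 1).mp hK
  refine (((ModuleCat.of R (A × K)).exists_isRegular_tfae (maximalIdeal R) n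
    (hlt (A × K))).out 1 3).mp fun i hi ↦ ?_
  let S := ModuleCat.shortComplexOfCompEqZero (LinearMap.inl R A K) (LinearMap.snd R A K)
    (LinearMap.snd_comp_inl R A K)
  have hS : S.ShortExact := ModuleCat.shortComplex_shortExact S
    (LinearMap.exact_iff.mpr (LinearMap.range_inl R A K).symm)
    LinearMap.inl_injective LinearMap.snd_surjective
  have z1 := AddCommGrpCat.isZero_of_iff_subsingleton.mpr (h1 i hi)
  have z2 := AddCommGrpCat.isZero_of_iff_subsingleton.mpr (h2 i hi)
  exact AddCommGrpCat.subsingleton_of_isZero <| ShortComplex.Exact.isZero_of_both_zeros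
    (Ext.covariant_sequence_exact₂' _ hS i) (z1.eq_zero_of_src _) (z2.eq_zero_of_tgt _)

theorem supportDim_prod_eq {R A K : Type*} [CommRing R] [AddCommGroup A] [Module R A]
    [AddCommGroup K] [Module R K] [Module.Finite R A] [Module.Finite R K]
    (h : Module.annihilator R A ≤ Module.annihilator R K) :
    Module.supportDim R (A × K) = Module.supportDim R A := by
  rw [Module.supportDim_eq_ringKrullDim_quotient_annihilator,
    Module.supportDim_eq_ringKrullDim_quotient_annihilator, Module.annihilator_prod,
    inf_eq_left.mpr h]

theorem supportDim_le_of_annihilator_le {R A K : Type*} [CommRing R] [AddCommGroup A] [Module R A]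
    [AddCommGroup K] [Module R K] [Module.Finite R A] [Module.Finite R K]
    (h : Module.annihilator R A ≤ Module.annihilator R K) :
    Module.supportDim R K ≤ Module.supportDim R A := by
  rw [Module.supportDim_eq_ringKrullDim_quotient_annihilator,
    Module.supportDim_eq_ringKrullDim_quotient_annihilator]
  exact ringKrullDim_le_of_surjective _ (Ideal.Quotient.factor_surjective h)

/-- A direct summand `K` of a Cohen-Macaulay module `A × K` of dimension `dim A ≥ dim K` is
Cohen-Macaulay. -/
theorem IsCohenMacaulayModule.of_prod {R A K : Type*} [CommRing R] [IsLocalRing R]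
    [IsNoetherianRing R] [AddCommGroup A] [Module R A] [AddCommGroup K] [Module R K]
    [Module.Finite R A] [Module.Finite R K]
    (h : Module.annihilator R A ≤ Module.annihilator R K) (hAK : IsCohenMacaulayModule R (A × K)) :
    IsCohenMacaulayModule R K := by
  rw [isCohenMacaulayModule_iff] at hAK ⊢
  rcases subsingleton_or_nontrivial K with hK | hK
  · exact Or.inl hK
  right
  obtain hs | ⟨rs, h1, h2, h3⟩ := hAK
  · exact (not_subsingleton K (LinearMap.snd_surjective (R := R) (M := A)).subsingleton).elim
  have hreg : IsRegular K rs := (IsLocalRing.isRegular_iff_isWeaklyRegular_of_subset_maximalIdeal h2).mpr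
    (h1.toIsWeaklyRegular.of_retract (LinearMap.inr R A K) (LinearMap.snd R A K)
      (LinearMap.snd_comp_inr R A K))
  refine ⟨rs, hreg, h2, le_antisymm hreg.length_le_supportDim ?_⟩
  rw [h3, supportDim_prod_eq h]
  exact supportDim_le_of_annihilator_le h

theorem IsCohenMacaulayModule.prod {R : Type u} [CommRing R] [IsLocalRing R]
    [IsNoetherianRing R] {A K : Type u} [AddCommGroup A] [Module R A] [AddCommGroup K] [Module R K]
    [Nontrivial A] [Nontrivial K] (h : Module.annihilator R A ≤ Module.annihilator R K)
    (hdim : Module.supportDim R K = Module.supportDim R A)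
    (hA : IsCohenMacaulayModule R A) (hK : IsCohenMacaulayModule R K) :
    IsCohenMacaulayModule R (A × K) := by
  have := hA.finite
  have := hK.finite
  rw [isCohenMacaulayModule_iff] at hA hK ⊢
  obtain ⟨rs, a1, a2, a3⟩ := hA.resolve_left (not_subsingleton A)
  obtain ⟨ts, k1, k2, k3⟩ := hK.resolve_left (not_subsingleton K)
  have hlen : ts.length = rs.length := by
    rw [hdim, ← a3] at k3
    exact_mod_cast k3
  obtain ⟨us, u1, u2, u3⟩ := exists_isRegular_prod ⟨rs, rfl, a2, a1⟩ ⟨ts, hlen, k2, k1⟩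
  exact Or.inr ⟨us, u3, u2, by rw [u1, a3, supportDim_prod_eq h]⟩

end Vasconcelos

end

/-! ### Complete intersections modulo a minimal generator. -/

section

open IsLocalRing RingTheory.Sequence

theorem Ideal.ofList_perm {R : Type*} [CommRing R] {rs ts : List R} (h : rs.Perm ts) :
    Ideal.ofList rs = Ideal.ofList ts :=
  congrArg Ideal.span (Set.ext fun _ ↦ h.mem_iff)

/-- Either all coefficients of `y` can be taken in `𝔪`, or one is a unit and its generator can be
exchanged for `y`. -/
theorem IsLocalRing.exists_perm_cons_of_mem_ofList {A : Type*} [CommRing A] [IsLocalRing A]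
    (rs : List A) {y : A} (hy : y ∈ Ideal.ofList rs) :
    y ∈ maximalIdeal A * Ideal.ofList rs ∨
      ∃ (r : A) (ts : List A) (u : A), rs.Perm (r :: ts) ∧ IsUnit u ∧
        y - u * r ∈ Ideal.ofList ts := by
  induction rs generalizing y with
  | nil =>
    left
    rw [Ideal.ofList_nil, Ideal.mem_bot] at hy
    rw [hy]
    exact Ideal.zero_mem _
  | cons r l ih =>
    rw [Ideal.ofList_cons] at hy ⊢
    obtain ⟨w, hw, z, hz, rfl⟩ := Submodule.mem_sup.mp hy
    obtain ⟨a, rfl⟩ := Ideal.mem_span_singleton'.mp hw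
    by_cases ha : IsUnit a
    · exact Or.inr ⟨r, l, a, List.Perm.refl _, ha, by simpa using hz⟩
    · have ha' : a ∈ maximalIdeal A := (mem_maximalIdeal _).mpr ha
      refine (ih hz).imp (fun h ↦ ?_) ?_
      · exact Ideal.add_mem _ (Ideal.mul_mem_mul ha'
          (Ideal.mem_sup_left (Ideal.mem_span_singleton_self r)))
          (Ideal.mul_mono_right le_sup_right h)
      · rintro ⟨r', ts, u, hperm, hu, hmem⟩
        refine ⟨r', r :: ts, u, (hperm.cons r).trans (List.Perm.swap _ _ _), hu, ?_⟩
        rw [Ideal.ofList_cons, add_sub_assoc]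
        exact Submodule.add_mem_sup hw hmem

/-- If an ideal of a Noetherian local ring is generated by a regular sequence, then any of its
minimal generators starts a regular sequence generating it. -/
theorem IsLocalRing.exists_isRegular_cons_of_notMem {A : Type*} [CommRing A] [IsLocalRing A]
    [IsNoetherianRing A] {rs : List A} (hrs : IsRegular A rs) {y : A} (hy : y ∈ Ideal.ofList rs)
    (hym : y ∉ maximalIdeal A * Ideal.ofList rs) :
    ∃ ts, IsRegular A (y :: ts) ∧ Ideal.ofList rs = Ideal.ofList (y :: ts) := by
  obtain ⟨r, ts, u, hperm, hu, hmem⟩ := (exists_perm_cons_of_mem_ofList rs hy).resolve_left hym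
  have hne : Ideal.ofList rs ≠ ⊤ := by
    have := hrs.top_ne_smul
    rw [smul_eq_mul, Ideal.mul_top] at this
    exact this.symm
  have hle : Ideal.ofList rs ≤ maximalIdeal A := le_maximalIdeal hne
  have hofList : Ideal.ofList rs = Ideal.ofList (y :: ts) := by
    rw [Ideal.ofList_perm hperm, Ideal.ofList_cons, Ideal.ofList_cons]
    apply le_antisymm
    · refine sup_le ?_ le_sup_right
      rw [Ideal.span_singleton_le_iff_mem]
      obtain ⟨v, hv⟩ := hu.exists_left_inv
      have : r = v * y - v * (y - u * r) := by
        linear_combination -r * hv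
      rw [this]
      exact Ideal.sub_mem _ (Ideal.mul_mem_left _ _
        (Ideal.mem_sup_left (Ideal.mem_span_singleton_self y)))
        (Ideal.mul_mem_left _ _ (Ideal.mem_sup_right hmem))
    · refine sup_le ?_ le_sup_right
      rw [Ideal.span_singleton_le_iff_mem]
      have : y = u * r + (y - u * r) := by ring
      rw [this]
      exact Ideal.add_mem _ (Ideal.mul_mem_left _ _
        (Ideal.mem_sup_left (Ideal.mem_span_singleton_self r))) (Ideal.mem_sup_right hmem)
  have hmax : ∀ t ∈ y :: ts, t ∈ maximalIdeal A := fun t ht ↦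
    hle (hofList ▸ Ideal.subset_span ht)
  refine ⟨ts, ?_, hofList⟩
  -- Regular sequences may be permuted here: move `r` to the end, where only its class modulo `ts`
  -- matters, replace it by `y`, and move `y` to the front.
  have h1 : IsRegular A (ts ++ [r]) :=
    isRegular_of_perm hrs (hperm.trans (List.perm_append_singleton r ts).symm)
  have h2 := (isWeaklyRegular_append_iff A ts [r]).mp h1.toIsWeaklyRegular
  have h3 : IsWeaklyRegular A (ts ++ [y]) := by
    refine (isWeaklyRegular_append_iff A ts [y]).mpr ⟨h2.1, ?_⟩
    rw [isWeaklyRegular_singleton_iff] at h2 ⊢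
    have hr := h2.2
    rw [isSMulRegular_quotient_iff_mem_of_smul_mem, smul_eq_mul, Ideal.mul_top] at hr ⊢
    intro w hw
    obtain ⟨v, hv⟩ := hu.exists_left_inv
    refine hr w ?_
    have : r • w = v * (y • w) - v * ((y - u * r) * w) := by
      simp only [smul_eq_mul]
      linear_combination (-r * w) * hv
    rw [this]
    exact Ideal.sub_mem _ (Ideal.mul_mem_left _ _ hw)
      (Ideal.mul_mem_left _ _ (Ideal.mul_mem_right _ _ hmem))
  have h4 : IsWeaklyRegular A (y :: ts) :=
    isWeaklyRegular_of_perm_of_subset_maximalIdeal h3 (List.perm_append_singleton y ts)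
      fun t ht ↦ hmax t ((List.perm_append_singleton y ts).mem_iff.mp ht)
  exact (isRegular_iff_isWeaklyRegular_of_subset_maximalIdeal hmax).mpr h4

open scoped Pointwise in
theorem RingTheory.Sequence.isRegular_map_iff_of_surjective {A B : Type*} [CommRing A] [CommRing B]
    (f : A →+* B) (hf : Function.Surjective f) {y : A} (hker : RingHom.ker f = Ideal.span {y})
    (ts : List A) : IsRegular B (ts.map f) ↔ IsRegular (QuotSMulTop y A) ts := by
  let := f.toAlgebra
  have hker' : LinearMap.ker (Algebra.linearMap A B) = y • (⊤ : Submodule A A) := by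
    rw [← Submodule.ideal_span_singleton_smul, smul_eq_mul, Ideal.mul_top, ← hker]
    rfl
  let e : QuotSMulTop y A ≃ₗ[A] B := (Submodule.quotEquivOfEq _ _ hker'.symm).trans
    ((Algebra.linearMap A B).quotKerEquivOfSurjective hf)
  have := e.toAddEquiv.isRegular_congr (as := ts) (bs := ts.map f)
    (List.forall₂_map_right_iff.mpr <| List.forall₂_same.mpr fun r _ x ↦ by
      change e (r • x) = f r • e x
      rw [map_smul, Algebra.smul_def]
      rfl)
  exact this.symm

namespace Vasconcelos

/-- A minimal generator `y` can be made the first term of the regular sequence and then killed;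
conversely, lift a sequence from the quotient and prepend `y`. -/
theorem isCompleteIntersectionIdeal_map_iff {A B : Type*} [CommRing A] [IsLocalRing A]
    [IsNoetherianRing A] [CommRing B] (f : A →+* B) (hf : Function.Surjective f) {y : A}
    (hker : RingHom.ker f = Ideal.span {y}) (hy : IsSMulRegular A y) {J : Ideal A} (hyJ : y ∈ J)
    (hyJm : y ∉ maximalIdeal A * J) :
    IsCompleteIntersectionIdeal J ↔ IsCompleteIntersectionIdeal (J.map f) := by
  have hfy : f y = 0 := by
    rw [← RingHom.mem_ker, hker]
    exact Ideal.mem_span_singleton_self y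
  constructor
  · rintro ⟨rs, hrs, rfl⟩
    obtain ⟨ts, hts, heq⟩ := exists_isRegular_cons_of_notMem hrs hyJ hyJm
    refine ⟨ts.map f, (isRegular_map_iff_of_surjective f hf hker ts).mpr
      ((isRegular_cons_iff A y ts).mp hts).2, ?_⟩
    rw [heq, Ideal.map_ofList, List.map_cons, Ideal.ofList_cons, hfy]
    simp
  · rintro ⟨ss, hss, heq⟩
    obtain ⟨ts, rfl⟩ := List.map_surjective_iff.mpr hf ss
    refine ⟨y :: ts, (isRegular_cons_iff A y ts).mpr
      ⟨hy, (isRegular_map_iff_of_surjective f hf hker ts).mp hss⟩, ?_⟩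
    have hkerJ : RingHom.ker f ≤ J := by
      rw [hker, Ideal.span_singleton_le_iff_mem]
      exact hyJ
    have h1 := congrArg (Ideal.comap f) heq
    rw [← Ideal.map_ofList, Ideal.comap_map_of_surjective f hf,
      Ideal.comap_map_of_surjective f hf] at h1
    change J ⊔ RingHom.ker f = Ideal.ofList ts ⊔ RingHom.ker f at h1
    rw [sup_eq_left.mpr hkerJ, hker] at h1
    rw [h1, Ideal.ofList_cons, sup_comm]

end Vasconcelos

theorem Localization.ker_localRingHom_of_surjective {R S : Type*} [CommRing R] [CommRing S]
    (f : R →+* S) (hf : Function.Surjective f) (P : Ideal S) [P.IsPrime] :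
    RingHom.ker (Localization.localRingHom (P.comap f) P f rfl) =
      (RingHom.ker f).map (algebraMap R (Localization.AtPrime (P.comap f))) := by
  apply le_antisymm
  · intro z hz
    obtain ⟨r, s, rfl⟩ := IsLocalization.exists_mk'_eq (P.comap f).primeCompl z
    rw [RingHom.mem_ker, Localization.localRingHom_mk', IsLocalization.mk'_eq_zero_iff] at hz
    obtain ⟨⟨m, hm⟩, hmr⟩ := hz
    obtain ⟨t, rfl⟩ := hf m
    rw [IsLocalization.mk'_mem_map_algebraMap_iff]
    exact ⟨t, hm, by rw [RingHom.mem_ker, map_mul]; exact hmr⟩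
  · rw [Ideal.map_le_iff_le_comap]
    intro r hr
    rw [Ideal.mem_comap, RingHom.mem_ker, Localization.localRingHom_to_map, RingHom.mem_ker.mp hr,
      map_zero]

theorem Ideal.cotangent_apply_mem_map_of_mem_mul {R : Type*} [CommRing R] {p I : Ideal R}
    (φ : I.Cotangent →ₗ[R ⧸ I] R ⧸ I) {w : R} (hw : w ∈ p * I) :
    ∃ h : w ∈ I, φ (I.toCotangent ⟨w, h⟩) ∈ p.map (Ideal.Quotient.mk I) := by
  refine Submodule.mul_induction_on hw (fun a ha b hb ↦ ?_) ?_
  · refine ⟨I.mul_mem_left a hb, ?_⟩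
    have h1 : I.toCotangent ⟨a * b, I.mul_mem_left a hb⟩ =
        Ideal.Quotient.mk I a • I.toCotangent ⟨b, hb⟩ := by
      rw [← Ideal.Quotient.algebraMap_eq, algebraMap_smul, ← map_smul]
      rfl
    rw [h1, map_smul, smul_eq_mul]
    exact Ideal.mul_mem_right _ _ (Ideal.mem_map_of_mem _ ha)
  · rintro a b ⟨ha, ha'⟩ ⟨hb, hb'⟩
    refine ⟨I.add_mem ha hb, ?_⟩
    have h1 : I.toCotangent ⟨a + b, I.add_mem ha hb⟩ =
        I.toCotangent ⟨a, ha⟩ + I.toCotangent ⟨b, hb⟩ := by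
      rw [← map_add]
      rfl
    rw [h1, map_add]
    exact Ideal.add_mem _ ha' hb'

namespace Vasconcelos

section Quotient

variable {R : Type*} [CommRing R] [IsNoetherianRing R] {I : Ideal R} {x : R}

theorem comap_mem_associatedPrimes_iff (hxI : x ∈ I) (P : Ideal (R ⧸ Ideal.span {x}))
    [P.IsPrime] :
    P.comap (Ideal.Quotient.mk (Ideal.span {x})) ∈ associatedPrimes R (R ⧸ I) ↔
      P ∈ associatedPrimes (R ⧸ Ideal.span {x})
        ((R ⧸ Ideal.span {x}) ⧸ I.map (Ideal.Quotient.mk (Ideal.span {x}))) := by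
  let e := DoubleQuot.quotQuotEquivQuotOfLE ((Ideal.span_singleton_le_iff_mem (I := I)).mpr hxI)
  have key : ∀ r w, e (Ideal.Quotient.mk (Ideal.span {x}) r • w) = r • e w := by
    intro r w
    rw [Algebra.smul_def, Algebra.smul_def, map_mul]
    rfl
  rw [AssociatedPrimes.mem_iff, AssociatedPrimes.mem_iff, isAssociatedPrime_iff,
    isAssociatedPrime_iff]
  refine and_congr ⟨fun _ ↦ inferInstance, fun _ ↦ inferInstance⟩ ⟨?_, ?_⟩
  · rintro ⟨z, hz⟩
    refine ⟨e.symm z, ?_⟩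
    ext s
    obtain ⟨r, rfl⟩ := Ideal.Quotient.mk_surjective s
    rw [← Ideal.mem_comap, hz, Submodule.mem_colon_singleton, Submodule.mem_colon_singleton,
      Submodule.mem_bot, Submodule.mem_bot, ← e.map_eq_zero_iff, key, e.apply_symm_apply]
  · rintro ⟨w, hw⟩
    refine ⟨e w, ?_⟩
    ext r
    rw [Ideal.mem_comap, hw, Submodule.mem_colon_singleton, Submodule.mem_colon_singleton,
      Submodule.mem_bot, Submodule.mem_bot, ← e.map_eq_zero_iff, key]

/-- The point is that `x` is a minimal generator of the localized ideal. Otherwise `s * x ∈ p * I`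
for some `s ∉ p`, and applying `φ` gives `s ∈ p`. -/
theorem isCompleteIntersectionIdeal_localization_iff [IsDomain R] (hx0 : x ≠ 0) (hxI : x ∈ I)
    (φ : I.Cotangent →ₗ[R ⧸ I] R ⧸ I) (hφ : φ (I.toCotangent ⟨x, hxI⟩) = 1)
    (P : Ideal (R ⧸ Ideal.span {x})) [P.IsPrime]
    (hIP : I ≤ P.comap (Ideal.Quotient.mk (Ideal.span {x}))) :
    IsCompleteIntersectionIdeal (I.map (algebraMap R
      (Localization.AtPrime (P.comap (Ideal.Quotient.mk (Ideal.span {x})))))) ↔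
    IsCompleteIntersectionIdeal ((I.map (Ideal.Quotient.mk (Ideal.span {x}))).map
      (algebraMap (R ⧸ Ideal.span {x}) (Localization.AtPrime P))) := by
  set q := Ideal.Quotient.mk (Ideal.span {x}) with hq
  set p := P.comap q with hp
  let A := Localization.AtPrime p
  let f := Localization.localRingHom p P q rfl
  have hf : Function.Surjective f :=
    RingHom.surjectiveOnStalks_of_surjective Ideal.Quotient.mk_surjective P inferInstance
  have hker : RingHom.ker f = Ideal.span {algebraMap R A x} := by
    refine (Localization.ker_localRingHom_of_surjective q Ideal.Quotient.mk_surjective P).trans ?_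
    have hk : RingHom.ker q = Ideal.span {x} := Ideal.mk_ker
    rw [hk, Ideal.map_span, Set.image_singleton]
  have : IsNoetherianRing A := IsLocalization.isNoetherianRing p.primeCompl A inferInstance
  have : IsDomain A := IsLocalization.isDomain_localization p.primeCompl_le_nonZeroDivisors
  have hxA : algebraMap R A x ≠ 0 := by
    rw [Ne, IsLocalization.to_map_eq_zero_iff A p.primeCompl_le_nonZeroDivisors]
    exact hx0
  have hreg : IsSMulRegular A (algebraMap R A x) := fun a b hab ↦ mul_left_cancel₀ hxA hab
  have hnot : algebraMap R A x ∉ maximalIdeal A * I.map (algebraMap R A) := by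
    intro hmem
    rw [← Localization.AtPrime.map_eq_maximalIdeal, ← Ideal.map_mul,
      IsLocalization.algebraMap_mem_map_algebraMap_iff p.primeCompl] at hmem
    obtain ⟨s, hs, hsx⟩ := hmem
    obtain ⟨h, hφs⟩ := Ideal.cotangent_apply_mem_map_of_mem_mul φ hsx
    have h1 : I.toCotangent ⟨s * x, h⟩ = Ideal.Quotient.mk I s • I.toCotangent ⟨x, hxI⟩ := by
      rw [← Ideal.Quotient.algebraMap_eq, algebraMap_smul, ← map_smul]
      rfl
    rw [h1, map_smul, hφ, smul_eq_mul, mul_one, Ideal.mem_quotient_iff_mem hIP] at hφs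
    exact hs hφs
  rw [isCompleteIntersectionIdeal_map_iff f hf hker hreg (Ideal.mem_map_of_mem _ hxI) hnot,
    Ideal.map_map, Ideal.map_map]
  have hcomp : f.comp (algebraMap R A) =
      (algebraMap (R ⧸ Ideal.span {x}) (Localization.AtPrime P)).comp q :=
    RingHom.ext fun r ↦ Localization.localRingHom_to_map p P q rfl r
  rw [hcomp]

theorem isGenericallyCompleteIntersection_map_iff [IsDomain R] (hx0 : x ≠ 0) (hxI : x ∈ I)
    (φ : I.Cotangent →ₗ[R ⧸ I] R ⧸ I) (hφ : φ (I.toCotangent ⟨x, hxI⟩) = 1) :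
    IsGenericallyCompleteIntersection I ↔
      IsGenericallyCompleteIntersection (I.map (Ideal.Quotient.mk (Ideal.span {x}))) := by
  have hle : ∀ p ∈ associatedPrimes R (R ⧸ I), I ≤ p := by
    intro p hp r hr
    rw [AssociatedPrimes.mem_iff, isAssociatedPrime_iff] at hp
    obtain ⟨-, z, rfl⟩ := hp
    rw [Submodule.mem_colon_singleton, Submodule.mem_bot, Algebra.smul_def,
      Ideal.Quotient.algebraMap_eq, Ideal.Quotient.eq_zero_iff_mem.mpr hr, zero_mul]
  constructor
  · intro h P _ hP
    have hP' := (comap_mem_associatedPrimes_iff hxI P).mpr hP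
    exact (isCompleteIntersectionIdeal_localization_iff hx0 hxI φ hφ P (hle _ hP')).mp (h _ hP')
  · intro h p _ hp
    have hker : RingHom.ker (Ideal.Quotient.mk (Ideal.span {x})) ≤ p := by
      rw [Ideal.mk_ker, Ideal.span_singleton_le_iff_mem]
      exact hle p hp hxI
    obtain ⟨P, hP, rfl⟩ : ∃ P : Ideal (R ⧸ Ideal.span {x}), P.IsPrime ∧
        P.comap (Ideal.Quotient.mk (Ideal.span {x})) = p :=
      ⟨p.map (Ideal.Quotient.mk _),
        Ideal.map_isPrime_of_surjective Ideal.Quotient.mk_surjective hker, by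
          rw [Ideal.comap_map_of_surjective _ Ideal.Quotient.mk_surjective]
          exact sup_eq_left.mpr hker⟩
    exact (isCompleteIntersectionIdeal_localization_iff hx0 hxI φ hφ P (hle _ hp)).mpr
      (h P ((comap_mem_associatedPrimes_iff hxI P).mp hp))

end Quotient

end Vasconcelos

end

/-! ### The conormal module of the quotient, and transfer of the hypotheses. -/

section

open IsLocalRing

/-- A linear form on the conormal module of `I` with value `1` at the class of `x` splits off that
class, and the complement is the conormal module of `I ⧸ (x)`. -/
theorem Ideal.nonempty_cotangent_linearEquiv_prod {R : Type*} [CommRing R] {I : Ideal R} {x : R}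
    (hxI : x ∈ I) (φ : I.Cotangent →ₗ[R ⧸ I] R ⧸ I) (hφ : φ (I.toCotangent ⟨x, hxI⟩) = 1) :
    Nonempty (I.Cotangent ≃ₗ[R]
      (R ⧸ I) × (I.map (Ideal.Quotient.mk (Ideal.span {x}))).Cotangent) := by
  have hs : Function.Surjective (algebraMap R (R ⧸ Ideal.span {x})) :=
    Ideal.Quotient.mk_surjective
  have hker : RingHom.ker (algebraMap R (R ⧸ Ideal.span {x})) = Ideal.span {x} := Ideal.mk_ker
  have heq : (I.map (Ideal.Quotient.mk (Ideal.span {x}))).comap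
      (algebraMap R (R ⧸ Ideal.span {x})) =
      RingHom.ker (algebraMap R (R ⧸ Ideal.span {x})) ⊔ I := by
    rw [sup_comm]
    exact Ideal.comap_map_of_surjective _ hs I
  let ψ := Ideal.mapCotangent I _ (Algebra.ofId R _) (le_of_le_of_eq le_sup_right heq.symm)
  have hψs : Function.Surjective ψ := Ideal.mapCotangent_surjective_of_comap_eq hs heq
  have hψk : LinearMap.ker ψ =
      (Submodule.comap I.subtype (Ideal.span {x} ⊓ I)).map I.toCotangent :=
    (Ideal.mapCotangent_ker_of_surjective hs heq).trans (by rw [hker])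
  set v := I.toCotangent ⟨x, hxI⟩ with hv
  have hψv : ψ v = 0 := by
    rw [← LinearMap.mem_ker, hψk]
    exact Submodule.mem_map_of_mem
      (Submodule.mem_comap.mpr ⟨Ideal.mem_span_singleton_self x, hxI⟩)
  have hφv : ∀ r : R, φ (r • v) = Ideal.Quotient.mk I r := fun r ↦ by
    rw [← algebraMap_smul (R ⧸ I) r v, map_smul, hφ, smul_eq_mul, mul_one,
      Ideal.Quotient.algebraMap_eq]
  -- The kernel of `ψ` consists of the multiples of `v`, and `φ` recovers the coefficient modulo
  -- `I`. For surjectivity, adding a multiple of `v` adjusts `φ` without changing `ψ`.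
  refine ⟨LinearEquiv.ofBijective ((φ.restrictScalars R).prod ψ) ⟨?_, ?_⟩⟩
  · refine (injective_iff_map_eq_zero _).mpr fun z hz ↦ ?_
    obtain ⟨h1, h2⟩ := Prod.ext_iff.mp hz
    change φ z = 0 at h1
    have h3 : z ∈ LinearMap.ker ψ := h2
    rw [hψk] at h3
    obtain ⟨⟨a, haI⟩, ⟨ha, -⟩, rfl⟩ := h3
    obtain ⟨c, hc⟩ := Ideal.mem_span_singleton'.mp ha
    have h4 : I.toCotangent ⟨a, haI⟩ = c • v := by
      rw [hv, ← map_smul]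
      exact congrArg _ (Subtype.ext hc.symm)
    rw [h4, hφv] at h1
    rw [h4, ← algebraMap_smul (R ⧸ I) c v, Ideal.Quotient.algebraMap_eq, h1, zero_smul]
  · rintro ⟨a, w⟩
    obtain ⟨z, rfl⟩ := hψs w
    obtain ⟨r, hr⟩ := Ideal.Quotient.mk_surjective (a - φ z)
    refine ⟨z + r • v, Prod.ext ?_ ?_⟩
    · change φ (z + r • v) = a
      rw [map_add, hφv, hr, add_sub_cancel]
    · change ψ (z + r • v) = ψ z
      rw [map_add, map_smul, hψv, smul_zero, add_zero]

/-- Determinant trick: `aJ ≤ J ^ 2` gives a monic polynomial with lower coefficients in `J` that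
annihilates `a` acting on `J`. Since `J ≠ 0` in a domain, `a` itself is a root, so a power of `a`
lies in `J`. -/
theorem Ideal.annihilator_cotangent_le_radical {S : Type*} [CommRing S] [IsDomain S]
    [IsNoetherianRing S] {J : Ideal S} (hJ : J ≠ ⊥) :
    Module.annihilator S J.Cotangent ≤ J.radical := by
  intro a ha
  have hrange : LinearMap.range (algebraMap S (Module.End S J) a) ≤ J • ⊤ := by
    rintro _ ⟨b, rfl⟩
    rw [Module.algebraMap_end_apply, ← Submodule.Quotient.mk_eq_zero]
    exact Module.mem_annihilator.mp ha (J.toCotangent b)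
  obtain ⟨p, hp, -, hcoeff, hzero⟩ :=
    LinearMap.exists_monic_and_natDegree_eq_and_coeff_mem_pow_and_aeval_eq_zero S
      (algebraMap S (Module.End S J) a) J hrange
  obtain ⟨b, hb, hb0⟩ := Submodule.exists_mem_ne_zero_of_ne_bot hJ
  have heval : p.eval a = 0 := by
    rw [Polynomial.aeval_algebraMap_apply, Polynomial.coe_aeval_eq_eval] at hzero
    have h1 := LinearMap.congr_fun hzero ⟨b, hb⟩
    rw [Module.algebraMap_end_apply] at h1
    exact (mul_eq_zero.mp (congrArg Subtype.val h1)).resolve_right hb0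
  have hmem : ∑ k ∈ Finset.range p.natDegree, p.coeff k * a ^ k ∈ J :=
    Ideal.sum_mem _ fun k hk ↦ Ideal.mul_mem_right _ _
      (Ideal.pow_le_self (Nat.sub_ne_zero_of_lt (Finset.mem_range.mp hk)) (hcoeff k))
  rw [Polynomial.eval_eq_sum_range, Finset.sum_range_succ, hp.coeff_natDegree, one_mul] at heval
  exact ⟨p.natDegree, by rw [eq_neg_of_add_eq_zero_right heval]; exact J.neg_mem hmem⟩

theorem Module.supportDim_eq_of_annihilator_le {R M N : Type*} [CommRing R] [AddCommGroup M]
    [Module R M] [Module.Finite R M] [AddCommGroup N] [Module R N] [Module.Finite R N]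
    (h₁ : Module.annihilator R M ≤ Module.annihilator R N)
    (h₂ : Module.annihilator R N ≤ (Module.annihilator R M).radical) :
    Module.supportDim R N = Module.supportDim R M := by
  have : Module.support R N = Module.support R M := by
    rw [Module.support_eq_zeroLocus, Module.support_eq_zeroLocus]
    refine (PrimeSpectrum.zeroLocus_anti_mono h₁).antisymm ?_
    rw [← PrimeSpectrum.zeroLocus_radical]
    exact PrimeSpectrum.zeroLocus_anti_mono h₂
  rw [Module.supportDim, Module.supportDim, this]

namespace Vasconcelos

theorem IsCohenMacaulayLocalRing.of_ringEquiv {A B : Type*} [CommRing A] [CommRing B]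
    (h : IsCohenMacaulayLocalRing A) (e : A ≃+* B) : IsCohenMacaulayLocalRing B := by
  have := h.toIsLocalRing
  have := h.toIsNoetherian
  have : IsLocalRing B := e.isLocalRing
  have : IsNoetherianRing B := isNoetherianRing_of_ringEquiv A e
  let := e.toRingHom.toAlgebra
  let e' : A ≃ₗ[A] B := LinearEquiv.ofBijective (Algebra.linearMap A B) e.bijective
  have := Module.Finite.equiv e'
  exact ⟨‹_›, ‹_›, (isCohenMacaulayModule_iff_of_surjective (R := A) (S := B) e.surjective).mpr
    (h.isCohenMacaulayModule.of_linearEquiv e')⟩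

attribute [local instance] RingHomInvPair.of_ringEquiv in
theorem IsGorensteinLocalRing.of_ringEquiv {A B : Type u} [CommRing A] [CommRing B]
    (h : IsGorensteinLocalRing A) (e : A ≃+* B) : IsGorensteinLocalRing B := by
  have := h.toIsLocalRing
  have := h.toIsNoetherian
  have : IsLocalRing B := e.isLocalRing
  have : IsNoetherianRing B := isNoetherianRing_of_ringEquiv A e
  obtain ⟨n, hn⟩ := h.exists_hasInjectiveDimensionLE
  let e' : ModuleCat.of A A ≃ₛₗ[RingHomClass.toRingHom e] ModuleCat.of B B :=
    { e.toAddEquiv with map_smul' := fun r s ↦ map_mul e r s }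
  exact ⟨‹_›, ‹_›, n, (ModuleCat.hasInjectiveDimensionLE_iff_of_semiLinearEquiv e e' n).mp hn⟩

/-- Passing to the quotient by an element of `I` whose class splits off the conormal module does not
change whether the conormal module is Cohen-Macaulay. -/
theorem isCohenMacaulayModule_cotangent_iff {R : Type u} [CommRing R] [IsLocalRing R]
    [IsNoetherianRing R] {I : Ideal R} {x : R}
    [IsDomain (R ⧸ Ideal.span {x})] [IsLocalRing (R ⧸ Ideal.span {x})]
    (hxI : x ∈ I) (φ : I.Cotangent →ₗ[R ⧸ I] R ⧸ I) (hφ : φ (I.toCotangent ⟨x, hxI⟩) = 1)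
    (hI : IsCohenMacaulayLocalRing (R ⧸ I)) :
    IsCohenMacaulayModule R I.Cotangent ↔
      IsCohenMacaulayModule (R ⧸ Ideal.span {x})
        (I.map (Ideal.Quotient.mk (Ideal.span {x}))).Cotangent := by
  obtain ⟨e⟩ := Ideal.nonempty_cotangent_linearEquiv_prod hxI φ hφ
  set J := I.map (Ideal.Quotient.mk (Ideal.span {x})) with hJ
  have hs : Function.Surjective (algebraMap R (R ⧸ Ideal.span {x})) :=
    Ideal.Quotient.mk_surjective
  have : Module.Finite R I.Cotangent := Module.Finite.of_surjective _ I.toCotangent_surjective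
  have : Module.Finite R J.Cotangent := Module.Finite.of_surjective
    (LinearMap.snd R (R ⧸ I) J.Cotangent ∘ₗ e.toLinearMap)
    ((LinearMap.snd_surjective (R := R) (M := R ⧸ I)).comp e.surjective)
  have := hI.toIsLocalRing
  have hA : IsCohenMacaulayModule R (R ⧸ I) :=
    (isCohenMacaulayModule_iff_of_surjective (R := R) (S := R ⧸ I)
      Ideal.Quotient.mk_surjective).mp hI.isCohenMacaulayModule
  have hann : Module.annihilator R (R ⧸ I) ≤ Module.annihilator R J.Cotangent := by
    rw [Ideal.annihilator_quotient]
    intro r hr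
    refine Module.mem_annihilator.mpr fun z ↦ ?_
    have h1 : e.symm (0, z) ∈ (⊤ : Submodule R I.Cotangent) := trivial
    have h2 : r • e.symm (0, z) = 0 := by
      rw [← algebraMap_smul (R ⧸ I) r, Ideal.Quotient.algebraMap_eq,
        Ideal.Quotient.eq_zero_iff_mem.mpr hr, zero_smul]
    rw [← map_smul, e.symm.map_eq_zero_iff] at h2
    exact (Prod.ext_iff.mp h2).2
  rw [isCohenMacaulayModule_iff_of_surjective hs]
  refine ⟨fun h ↦ (h.of_linearEquiv e).of_prod hann, fun h ↦ ?_⟩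
  refine IsCohenMacaulayModule.of_linearEquiv e.symm ?_
  -- A zero second summand leaves only `R ⧸ I`. Otherwise `J ≠ 0`, and the radical bound on the
  -- annihilator makes the dimensions equal.
  rcases subsingleton_or_nontrivial J.Cotangent with hsub | hnt
  · have := Unique.mk' J.Cotangent
    exact hA.of_linearEquiv (LinearEquiv.prodUnique (R := R)).symm
  · have hJ0 : J ≠ ⊥ := by
      intro h0
      have : Subsingleton J := by rw [h0]; infer_instance
      exact not_subsingleton J.Cotangent J.toCotangent_surjective.subsingleton
    refine hA.prod hann (Module.supportDim_eq_of_annihilator_le hann fun r hr ↦ ?_) h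
    rw [Ideal.annihilator_quotient]
    have h1 : Ideal.Quotient.mk (Ideal.span {x}) r ∈
        Module.annihilator (R ⧸ Ideal.span {x}) J.Cotangent :=
      Module.mem_annihilator.mpr fun z ↦
        (algebraMap_smul (R ⧸ Ideal.span {x}) r z).trans (Module.mem_annihilator.mp hr z)
    obtain ⟨n, hn⟩ := Ideal.annihilator_cotangent_le_radical hJ0 h1
    refine ⟨n, ?_⟩
    rw [← map_pow, hJ, ← Ideal.mem_comap,
      Ideal.comap_map_of_surjective _ Ideal.Quotient.mk_surjective] at hn
    have hle : RingHom.ker (Ideal.Quotient.mk (Ideal.span {x})) ≤ I := by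
      rw [Ideal.mk_ker, Ideal.span_singleton_le_iff_mem]
      exact hxI
    exact sup_le le_rfl hle hn

end Vasconcelos

end

theorem proposition1p6 {R : Type u} [CommRing R] [IsRegularLocalRing R]
    (hfield : ∃ k : Subring R, IsField k)
    (I : Ideal R) (x : R) (hxI : x ∈ I)
    (hxm : x ∈ IsLocalRing.maximalIdeal R) (hxm2 : x ∉ IsLocalRing.maximalIdeal R ^ 2) :
    -- the image of `x` spans a free direct summand of rank one of the `R ⧸ I`-module `I ⧸ I ^ 2`
    (Nonempty ((R ⧸ I) ≃ₗ[R ⧸ I] Submodule.span (R ⧸ I) {I.toCotangent ⟨x, hxI⟩}) ∧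
      ∃ K : Submodule (R ⧸ I) I.Cotangent,
        IsCompl (Submodule.span (R ⧸ I) {I.toCotangent ⟨x, hxI⟩}) K) ∧
    -- `R ⧸ (x)` is again a regular local ring, and the question for `I` is equivalent to the
    -- question for the image of `I` in it
    ∃ _ : IsRegularLocalRing (R ⧸ Ideal.span {x}),
      (Vasconcelos.QuestionHolds I ↔
        Vasconcelos.QuestionHolds (I.map (Ideal.Quotient.mk (Ideal.span {x})))) := by
  obtain ⟨φ, hφ⟩ := IsRegularLocalRing.exists_cotangent_linearMap_eq_one hfield I hxI hxm hxm2
  have hreg := IsRegularLocalRing.quotient_span_singleton hxm hxm2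
  have := IsRegularLocalRing.isDomain R
  have := IsRegularLocalRing.isDomain (R ⧸ Ideal.span {x})
  have hx0 : x ≠ 0 := by
    rintro rfl
    exact hxm2 (Ideal.zero_mem _)
  refine ⟨⟨φ.nonempty_linearEquiv_span_singleton hφ, _, φ.isCompl_span_singleton_ker hφ⟩,
    hreg, ?_⟩
  let e := DoubleQuot.quotQuotEquivQuotOfLE ((Ideal.span_singleton_le_iff_mem (I := I)).mpr hxI)
  have hgci := Vasconcelos.isGenericallyCompleteIntersection_map_iff hx0 hxI φ hφ
  constructor
  · intro h hCM hG hcot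
    -- The conormal comparison presupposes that `R ⧸ I` is Cohen–Macaulay, so this is transported
    -- first.
    have hI := hCM.of_ringEquiv e
    exact (h hI (hgci.mpr hG)
      ((Vasconcelos.isCohenMacaulayModule_cotangent_iff hxI φ hφ hI).mpr hcot)).of_ringEquiv e.symm
  · intro h hI hG hcot
    exact (h (hI.of_ringEquiv e.symm) (hgci.mp hG)
      ((Vasconcelos.isCohenMacaulayModule_cotangent_iff hxI φ hφ hI).mp hcot)).of_ringEquiv e
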